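/- **Theorem.** Let $A=\sum_{i=1}^n\lambda_i u_iu_i^{\mathsf H}$ be an $n\times n$ Hermitian matrix ($n\ge 1$) with orthonormal eigenvectors $u_i$ and all eigenvalues in $[a,b]$, let $f:\mathbb R\to\mathbb R$ satisfy $f_{\min}\le f(x)\le f_{\max}$ for all $x\in[a,b]$, and put $f(A)=\sum_i f(\lambda_i)u_iu_i^{\mathsf H}$. Let $n_{\mathrm v}\ge 1$ and let $v_1,\dots,v_{n_{\mathrm v}}$ be independent and uniformly distributed on the real unit sphere $\mathbb S^{n-1}\subset\mathbb R^n$. Write $\Psi_\ell=\sum_i|v_\ell^{\mathsf H}u_i|^2\delta_{\lambda_i}$, let $\langle\cdot\rangle$ denote the average over $\ell=1,\dots,n_{\mathrm v}$, and let $\|g\|_{[a,b]}=\sup_{x\in[a,b]}|g(x)|$. A choice of $\circ$ (of degree $s$) is a rule that assigns to a function $f$, possibly depending on $\Psi$, a polynomial $[f]_s^\circ$ of degree at most $s$; the quadrature approximation $[\Psi]_s^\circ$ is defined by $\int f\,d[\Psi]_s^\circ:=\int [f]_s^\circ\,d\Psi$. Put $$e_s(f,\circ)=\Big|\int f\,d\langle\Psi_\ell\rangle-\int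 f\,d\langle[\Psi_\ell]_s^\circ\rangle\Big| .$$ 1. For every $s$, every choice of $\circ$ and every $\varepsilon>0$, $$\mathbb P\Big[\Big|n^{-1}\operatorname{tr}(f(A))-\int f\,d\langle[\Psi_\ell]_s^\circ\rangle\Big|>\varepsilon+e_s(f,\circ)\Big]\le 2n\exp\Big(-\frac{n_{\mathrm v}(n+2)\varepsilon^2}{(f_{\max}-f_{\min})^2}\Big),$$ where the right-hand side is read as $0$ if $f_{\max}=f_{\min}$. 2. For every $s$ and every choice of $\circ$, and every realization of the $v_\ell$, $e_s(f,\circ)\le\langle\|f-[f]_s^\circ\|_{[a,b]}\rangle$, where $[f]^\circ_s$ in the $\ell$-th term is formed with $\Psi_\ell$ (if $[f]_s^\circ$ does not depend on $\Psi$, the right-hand side is $\|f-[f]_s^\circ\|_{[a,b]}$). 3. Let $E_s=\min_{\deg p\le s}\|f-p\|_{[a,b]}$. In each of the following cases $[\Psi_\ell]_s^\circ$ is given by a signed measure, integration of $f$ against the average of these signed measures is $\int f\,d\langle[\Psi_\ell]_s^\circ\rangle$, and, for every realization of the $v_\ell$: - ($\circ=\mathrm g$, Gaussian quadrature) for $s=2k-1$,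 $k\ge1$, where $[f]_s^{\mathrm g}$ interpolates $f$ at the zeros of the degree $k$ orthogonal polynomial of $\Psi$ (of the degree $m$ one, if $\Psi$ is supported on only $m<k$ points): $e_s(f,\mathrm g)\le 2E_s$; - ($\circ=\mathrm i$, interpolation) where $[f]_s^{\mathrm i}$ interpolates $f$ at the $s+1$ zeros of the degree $s+1$ orthogonal polynomial of $\mu$: $e_s(f,\mathrm i)\le(1+d_{\mathrm{TV}}(\langle[\Psi_\ell]_s^{\mathrm i}\rangle))E_s$; - ($\circ=\mathrm a$, approximation) where $[f]_s^{\mathrm a}=\sum_{i=0}^s(\int fp_i\,d\mu)\,p_i$ with the orthonormal polynomials $p_i$ of $\mu$, and $f$ is $\mu$-measurable: $e_s(f,\mathrm a)\le(1+d_{\mathrm{TV}}(\langle[\Psi_\ell]_s^{\mathrm a}\rangle))E_s$. In the last two cases $\mu$ is any fixed probability measure concentrated on $[a,b]$ but not on $s$ or fewer points; $d_{\mathrm{TV}}(\Upsilon)=\int|d\Upsilon|$. -/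

import Mathlib

open MeasureTheory ProbabilityTheory Polynomial
open scoped ENNReal

namespace MatrixQuad

noncomputable section

/-! ### The random vectors and the spectral measures -/

/-- The uniform probability measure on the real unit hypersphere of `ℝⁿ`. -/
def unifSphere (n : ℕ) : Measure (Metric.sphere (0 : EuclideanSpace ℝ (Fin n)) 1) :=
  ((volume : Measure (EuclideanSpace ℝ (Fin n))).toSphere Set.univ)⁻¹ •
    (volume : Measure (EuclideanSpace ℝ (Fin n))).toSphere

/-- A real vector regarded as a complex vector. -/
def toComplex {n : ℕ} (v : EuclideanSpace ℝ (Fin n)) : EuclideanSpace ℂ (Fin n) :=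
  WithLp.toLp 2 (fun j => (v j : ℂ))

/-- The weighted cumulative empirical spectral measure `Ψ` of the Hermitian matrix `A` and the
vector `v`, as the measure whose distribution function is
`x ↦ ∑ i, |vᴴ uᵢ|² 𝟙(λᵢ ≤ x)`, where `A = ∑ i, λᵢ uᵢ uᵢᴴ`. -/
def weightedCESM {n : ℕ} {A : Matrix (Fin n) (Fin n) ℂ} (hA : A.IsHermitian)
    (v : EuclideanSpace ℝ (Fin n)) : Measure ℝ :=
  ∑ i, ENNReal.ofReal (‖inner ℂ (toComplex v) (hA.eigenvectorBasis i)‖ ^ 2) •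
    Measure.dirac (hA.eigenvalues i)

/-- The average `⟨Ψ_ℓ⟩` of finitely many measures. -/
def avgMeasure {nv : ℕ} (Ψ : Fin nv → Measure ℝ) : Measure ℝ :=
  (nv : ℝ≥0∞)⁻¹ • ∑ l, Ψ l

/-- The average `⟨Υ_ℓ⟩` of finitely many signed measures. -/
def avgSigned {nv : ℕ} (Q : Fin nv → SignedMeasure ℝ) : SignedMeasure ℝ :=
  (nv : ℝ)⁻¹ • ∑ l, Q l

/-- The total variation `∫ |dΥ|` of a signed measure. -/
def dTV (Q : SignedMeasure ℝ) : ℝ := Q.variation.real Set.univ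

/-! ### Uniform norms and best approximation -/

/-- `‖g‖_{[a,b]} = sup_{x ∈ [a,b]} |g x|`. -/
def uniformNorm (a b : ℝ) (g : ℝ → ℝ) : ℝ := ⨆ x : Set.Icc a b, |g x|

/-- `‖f - [f]_s^best‖_{[a,b]}`, the least uniform error on `[a,b]` among the polynomials of degree
at most `s`. -/
def bestError (s : ℕ) (a b : ℝ) (f : ℝ → ℝ) : ℝ :=
  ⨅ p : {p : ℝ[X] // p.natDegree ≤ s}, uniformNorm a b (fun x => f x - p.1.eval x)

/-! ### Polynomial approximation operators and the induced quadrature -/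

/-- A choice of the parameter `∘`: a rule that assigns to a function `f` a polynomial `[f]_s` of
degree at most `s`. As for Gaussian quadrature, the rule may depend on the measure `Ψ` that is to
be approximated. -/
structure PolyApprox (s : ℕ) where
  toPoly : Measure ℝ → (ℝ → ℝ) → ℝ[X]
  natDegree_le : ∀ ν f, (toPoly ν f).natDegree ≤ s

/-- `∫ f d⟨[Ψ_ℓ]_s⟩`, where the quadrature approximation `[Ψ]_s` of `Ψ` is defined by
`∫ f d[Ψ]_s := ∫ [f]_s dΨ`. -/
def quadIntegral {s nv : ℕ} (T : PolyApprox s) (Ψ : Fin nv → Measure ℝ) (f : ℝ → ℝ) : ℝ :=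
  (nv : ℝ)⁻¹ * ∑ l, ∫ x, (T.toPoly (Ψ l) f).eval x ∂(Ψ l)

/-- The quadrature error `e_s(f,∘) = |∫ f d⟨Ψ_ℓ⟩ - ∫ f d⟨[Ψ_ℓ]_s⟩|`. -/
def quadError {s nv : ℕ} (T : PolyApprox s) (Ψ : Fin nv → Measure ℝ) (f : ℝ → ℝ) : ℝ :=
  |(∫ x, f x ∂(avgMeasure Ψ)) - quadIntegral T Ψ f|

/-! ### Orthogonal polynomials -/

/-- The monic orthogonal polynomials of `ν`: Gram–Schmidt, without normalization, applied to the
monomials. (A previous polynomial of norm zero contributes nothing.) -/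
def monicOrth (ν : Measure ℝ) (j : ℕ) : ℝ[X] :=
  X ^ j - ∑ i : Fin j,
    C ((∫ x, x ^ j * (monicOrth ν i).eval x ∂ν) / ∫ x, (monicOrth ν i).eval x ^ 2 ∂ν) *
      monicOrth ν i
termination_by j
decreasing_by all_goals exact i.2

/-- The orthonormal polynomials `p_j` of `ν` (with positive leading coefficient). -/
def orthonormalPoly (ν : Measure ℝ) (j : ℕ) : ℝ[X] :=
  C (√(∫ x, (monicOrth ν j).eval x ^ 2 ∂ν))⁻¹ * monicOrth ν j

theorem natDegree_monicOrth_le (ν : Measure ℝ) (j : ℕ) : (monicOrth ν j).natDegree ≤ j := by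
  induction j using Nat.strong_induction_on with
  | _ j ih =>
    rw [monicOrth]
    refine (natDegree_sub_le _ _).trans (max_le (natDegree_X_pow_le j) ?_)
    refine natDegree_sum_le_of_forall_le _ _ (fun i _ => ?_)
    exact (natDegree_C_mul_le _ _).trans ((ih i i.2).trans i.2.le)

theorem natDegree_orthonormalPoly_le (ν : Measure ℝ) (j : ℕ) :
    (orthonormalPoly ν j).natDegree ≤ j :=
  (natDegree_C_mul_le _ _).trans (natDegree_monicOrth_le ν j)

/-- The zeros `θ_1, …, θ_j` of the degree `j` orthogonal polynomial of `ν`. -/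
def orthNodes (ν : Measure ℝ) (j : ℕ) : Finset ℝ := (monicOrth ν j).roots.toFinset

theorem card_orthNodes_le (ν : Measure ℝ) (j : ℕ) : (orthNodes ν j).card ≤ j :=
  (Multiset.toFinset_card_le _).trans ((card_roots' _).trans (natDegree_monicOrth_le ν j))

/-! ### Quadrature by interpolation at given nodes -/

/-- The polynomial of least degree that interpolates `f` at the nodes `t`. -/
def nodeInterp (t : Finset ℝ) (f : ℝ → ℝ) : ℝ[X] := Lagrange.interpolate t id f

/-- The interpolatory quadrature rule `∑_{θ ∈ t} ω_θ δ_θ` for `ν` at the nodes `t`; the weights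
`ω_θ`, the integrals of the Lagrange basis polynomials, are those for which the rule and `ν`
integrate every polynomial of degree less than `#t` to the same value. -/
def nodeMeasure (t : Finset ℝ) (ν : Measure ℝ) : SignedMeasure ℝ :=
  ∑ θ ∈ t, (∫ x, (Lagrange.basis t id θ).eval x ∂ν) • (Measure.dirac θ).toSignedMeasure

theorem natDegree_nodeInterp_le (t : Finset ℝ) (f : ℝ → ℝ) {s : ℕ} (h : t.card ≤ s + 1) :
    (nodeInterp t f).natDegree ≤ s := by
  have h1 := Lagrange.degree_interpolate_lt (s := t) (v := id) f Function.injective_id.injOn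
  have h2 : (nodeInterp t f).degree < ((s + 1 : ℕ) : WithBot ℕ) :=
    lt_of_lt_of_le h1 (by exact_mod_cast h)
  rw [natDegree_le_iff_coeff_eq_zero]
  intro N hN
  exact coeff_eq_zero_of_degree_lt (lt_of_lt_of_le h2 (by exact_mod_cast hN))

/-- `∘ = i`: interpolation at the zeros of the degree `s + 1` orthogonal polynomial of a fixed
probability measure `μ`. -/
def interp (μ : Measure ℝ) (s : ℕ) : PolyApprox s where
  toPoly _ f := nodeInterp (orthNodes μ (s + 1)) f
  natDegree_le _ f := natDegree_nodeInterp_le _ f (card_orthNodes_le μ (s + 1))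

/-- The signed measure `[Ψ]_s` of quadrature by interpolation. -/
def interpMeasure (μ : Measure ℝ) (s : ℕ) (ν : Measure ℝ) : SignedMeasure ℝ :=
  nodeMeasure (orthNodes μ (s + 1)) ν

/-! ### Gaussian quadrature -/

open Classical in
/-- The nodes of the `k`-point Gaussian quadrature rule for `ν`: the zeros of the degree `k`
orthogonal polynomial of `ν`. If `ν` is supported on `m < k` points, the orthogonal polynomials
(that is, the Lanczos recurrence) break down at degree `m`, and the nodes are the zeros of the
degree `m` one, which are the points of the support. -/
def gaussNodes (ν : Measure ℝ) (k : ℕ) : Finset ℝ :=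
  orthNodes ν
    (Nat.findGreatest (fun j => ∀ i < j, (∫ x, (monicOrth ν i).eval x ^ 2 ∂ν) ≠ 0) k)

theorem card_gaussNodes_le (ν : Measure ℝ) (k : ℕ) : (gaussNodes ν k).card ≤ k := by
  classical
  exact (card_orthNodes_le _ _).trans (Nat.findGreatest_le k)

/-- `∘ = g`: the degree `2k - 1` Gaussian quadrature (stochastic Lanczos quadrature), that is,
interpolation at the `k` Gaussian nodes of `Ψ` itself. -/
def gauss (k : ℕ) : PolyApprox (2 * k - 1) where
  toPoly ν f := nodeInterp (gaussNodes ν k) f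
  natDegree_le ν f := natDegree_nodeInterp_le _ f ((card_gaussNodes_le ν k).trans (by omega))

/-- The Gaussian quadrature rule of degree `2k - 1` for `ν`. -/
def gaussMeasure (k : ℕ) (ν : Measure ℝ) : SignedMeasure ℝ :=
  nodeMeasure (gaussNodes ν k) ν

/-! ### Quadrature by approximation -/

/-- `∘ = a`: the projection `∑_{i ≤ s} ⟨f, p_i⟩_μ p_i` onto the orthonormal polynomials of a fixed
probability measure `μ`. -/
def approx (μ : Measure ℝ) (s : ℕ) : PolyApprox s where
  toPoly _ f := ∑ i ∈ Finset.range (s + 1),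
    C (∫ x, f x * (orthonormalPoly μ i).eval x ∂μ) * orthonormalPoly μ i
  natDegree_le _ f := by
    refine natDegree_sum_le_of_forall_le _ _ (fun i hi => ?_)
    refine (natDegree_C_mul_le _ _).trans ((natDegree_orthonormalPoly_le μ i).trans ?_)
    have := Finset.mem_range.mp hi
    omega

/-- The signed measure `[Ψ]_s` of quadrature by approximation: its density with respect to `μ` is
`∑_{i ≤ s} m_i p_i`, where `m_i = ∫ p_i dΨ` are the modified moments. -/
def approxMeasure (μ : Measure ℝ) (s : ℕ) (ν : Measure ℝ) : SignedMeasure ℝ :=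
  μ.withDensityᵥ (fun x => ∑ i ∈ Finset.range (s + 1),
    (∫ y, (orthonormalPoly μ i).eval y ∂ν) * (orthonormalPoly μ i).eval x)

/-- `μ` is a probability measure on `[a,b]` that has orthonormal polynomials of every degree up to
`s`, that is, it is not concentrated on `s` or fewer points. -/
structure IsReference (μ : Measure ℝ) (a b : ℝ) (s : ℕ) : Prop where
  isProb : IsProbabilityMeasure μ
  supported : μ (Set.Icc a b)ᶜ = 0
  nondegenerate : ∀ t : Finset ℝ, t.card ≤ s → μ (t : Set ℝ)ᶜ ≠ 0

end

end MatrixQuad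

open MatrixQuad

/-! Concentration. The map v ↦ ∫ f dΨ is the real quadratic form Q of Re f(A). Its trace is tr f(A).
Each eigenvalue β_i is the value of Q at a unit vector, hence the mean of f under a probability
measure on [a,b], so it lies in [lo, hi] = [fmin, fmax]. It remains to show that Q = ∑ β_i x_i²
concentrates around n⁻¹ ∑ β_i on the sphere. The integral of x_i x_j exp(tQ) is unchanged when the
(x_i, x_j)-plane is rotated. Differentiating in the angle, multiplying by β_j - β_i and summing over
i, j gives E[(∑ β_i - nQ + 2t(∑ β_i² x_i² - Q²)) exp(tQ)] = 0 (`integral_sphere_identity`). The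
inner bracket is the variance of β under the weights x_i², at most (hi - Q)(Q - lo). For the
logarithmic derivative L of the moment generating function of Q - n⁻¹ ∑ β_i this becomes (n/2) L + t
L' ≤ t (hi - lo)²/4. Integrating twice shows that Q is sub-Gaussian with variance proxy (hi -
lo)²/(2(n+2)) (`hasSubgaussianMGF_diagForm`). The Chernoff bound for independent sums then gives the
tail with prefactor 2, which is at most 2n. The quadrature error enters through the triangle
inequality. Quadrature. Each Ψ is a probability measure on [a,b], so integrals against it are
bounded by uniform norms. If a rule reproduces p, its error on f is its error on f - p; the measure
contributes 1 and the rule its total variation (`quadError_le_of_reproducing`). Gaussian weights are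
nonnegative with sum 1 and the nodes lie in [a,b], whence the factor 2
(`abs_integral_sub_gauss_le`). The zeros of orthogonal polynomials are controlled by one principle:
a factor of constant sign and positive degree must have a zero on every set of full measure. -/

namespace MatrixQuad

noncomputable section

/-! ### A differential inequality for moment generating functions -/

/-- Multiplied by t^(c-1), the left side of the inequality is the derivative of t^c u(t), which
therefore decreases from its value 0 at t = 0. -/
theorem nonpos_of_mul_add_mul_deriv_nonpos {u u' : ℝ → ℝ} {c : ℝ} (hc : 0 < c)
    (hu : ∀ t, HasDerivAt u (u' t) t) (h : ∀ t, 0 < t → c * u t + t * u' t ≤ 0)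
    {t : ℝ} (ht : 0 < t) : u t ≤ 0 := by
  have hanti : AntitoneOn (fun t : ℝ => t ^ c * u t) (Set.Ici 0) := by
    refine antitoneOn_of_hasDerivWithinAt_nonpos (convex_Ici 0)
      (f' := fun t => c * t ^ (c - 1) * u t + t ^ c * u' t) ?_ ?_ ?_
    · refine (Continuous.mul ?_ ?_).continuousOn
      · exact continuous_id.rpow_const fun _ => Or.inr hc.le
      · exact continuous_iff_continuousAt.mpr fun t => (hu t).continuousAt
    · intro x hx
      rw [interior_Ici] at hx
      exact ((Real.hasDerivAt_rpow_const (Or.inl (ne_of_gt hx))).mul (hu x)).hasDerivWithinAt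
    · intro x hx
      rw [interior_Ici] at hx
      have hx0 : (0 : ℝ) < x := hx
      have h1 : x ^ c = x ^ (c - 1) * x := by
        rw [← Real.rpow_add_one hx0.ne', sub_add_cancel]
      have h2 : c * x ^ (c - 1) * u x + x ^ c * u' x = x ^ (c - 1) * (c * u x + x * u' x) := by
        rw [h1]; ring
      rw [h2]
      exact mul_nonpos_of_nonneg_of_nonpos (Real.rpow_nonneg hx0.le _) (h x hx0)
  have h0 := hanti (Set.mem_Ici.mpr le_rfl) (Set.mem_Ici.mpr ht.le) ht.le
  simp only [Real.zero_rpow hc.ne', zero_mul] at h0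
  exact nonpos_of_mul_nonpos_right h0 (Real.rpow_pos_of_pos ht c)

/-- With L = N1/N, the mean of Y under the tilted law, L' = N2/N - L². The hypothesis divided by N
reads n L ≤ 2t(K - L' - (L - δ)²). Dropping the square leaves a linear differential inequality, for
which κ t with κ = 2K/(n+2) is the extremal solution. -/
theorem mgf_le_exp_of_moment_inequality {Ω : Type*} [MeasurableSpace Ω] {μ : Measure Ω}
    [IsProbabilityMeasure μ] {Y : Ω → ℝ} (hint : ∀ t, Integrable (fun ω => Real.exp (t * Y ω)) μ)
    {n K δ : ℝ} (hn : 0 < n)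
    (h : ∀ t, 0 ≤ t → n * ∫ ω, Y ω * Real.exp (t * Y ω) ∂μ ≤
      2 * t * (K * mgf Y μ t - (∫ ω, Y ω ^ 2 * Real.exp (t * Y ω) ∂μ
        - 2 * δ * ∫ ω, Y ω * Real.exp (t * Y ω) ∂μ + δ ^ 2 * mgf Y μ t)))
    {t : ℝ} (ht : 0 ≤ t) : mgf Y μ t ≤ Real.exp (2 * K / (n + 2) * t ^ 2 / 2) := by
  have hset : integrableExpSet Y μ = Set.univ := Set.eq_univ_of_forall hint
  have hmem : ∀ t, t ∈ interior (integrableExpSet Y μ) := fun t => by simp [hset]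
  set N := mgf Y μ with hN
  set N1 : ℝ → ℝ := fun t => ∫ ω, Y ω * Real.exp (t * Y ω) ∂μ with hN1
  set N2 : ℝ → ℝ := fun t => ∫ ω, Y ω ^ 2 * Real.exp (t * Y ω) ∂μ with hN2
  have hd : ∀ t, HasDerivAt N (N1 t) t := fun t => hasDerivAt_mgf (hmem t)
  have hd1 : ∀ t, HasDerivAt N1 (N2 t) t := fun t => by
    simpa [hN1, hN2] using hasDerivAt_integral_pow_mul_exp_real (hmem t) 1
  have hpos : ∀ t, 0 < N t := fun t => mgf_pos (hint t)
  set κ := 2 * K / (n + 2) with hκ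
  have hu : ∀ t, HasDerivAt (fun t => N1 t / N t - κ * t)
      ((N2 t * N t - N1 t * N1 t) / N t ^ 2 - κ) t := fun t => by
    have := ((hd1 t).div (hd t) (hpos t).ne').sub ((hasDerivAt_id t).const_mul κ)
    convert! this using 1
    simp
  have hle : ∀ t, 0 < t → N1 t / N t - κ * t ≤ 0 := by
    intro t ht
    refine nonpos_of_mul_add_mul_deriv_nonpos (c := n / 2) (by positivity) hu ?_ ht
    intro t ht
    have h1 : n * N1 t ≤ 2 * t * (K * N t - (N2 t - 2 * δ * N1 t + δ ^ 2 * N t)) := h t ht.le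
    have hp := hpos t
    have h2 : n * (N1 t / N t) ≤ 2 * t * (K - (N2 t / N t - 2 * δ * (N1 t / N t) + δ ^ 2)) := by
      rw [← mul_le_mul_iff_left₀ hp]
      calc _ = n * N1 t := by field_simp
        _ ≤ _ := h1
        _ = _ := by field_simp
    have h3 : (N2 t * N t - N1 t * N1 t) / N t ^ 2 = N2 t / N t - (N1 t / N t) ^ 2 := by
      field_simp
    rw [h3]
    have h4 : κ * (n + 2) = 2 * K := by rw [hκ]; field_simp
    -- The choice of κ makes (n/2) κ t + t κ equal to t K, so only the discarded square -t (L - δ)²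
    -- remains.
    nlinarith [mul_nonneg ht.le (sq_nonneg (N1 t / N t - δ)), congrArg (fun x => t * x) h4]
  have hlog : ∀ t, HasDerivAt (fun t => Real.log (N t) - κ * t ^ 2 / 2) (N1 t / N t - κ * t) t := by
    intro t
    have := ((hd t).log (hpos t).ne').sub ((((hasDerivAt_id t).pow 2).const_mul κ).div_const 2)
    convert! this using 1
    simp; ring
  have hanti : AntitoneOn (fun t => Real.log (N t) - κ * t ^ 2 / 2) (Set.Ici 0) := by
    refine antitoneOn_of_hasDerivWithinAt_nonpos (convex_Ici 0)
      (f' := fun t => N1 t / N t - κ * t) ?_ ?_ ?_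
    · exact fun t _ => (hlog t).continuousAt.continuousWithinAt
    · exact fun t _ => (hlog t).hasDerivWithinAt
    · intro t ht
      rw [interior_Ici] at ht
      exact hle t ht
  have h0 := hanti (Set.mem_Ici.mpr le_rfl) (Set.mem_Ici.mpr ht) ht
  have hN0 : N 0 = 1 := by simp [hN]
  simp only [hN0, Real.log_one] at h0
  rw [← Real.log_le_iff_le_exp (hpos t)]
  linarith

/-! ### Rotations in a coordinate plane -/

section Rotation

variable {E : Type*} [NormedAddCommGroup E] [InnerProductSpace ℝ E]

local notation "⟪" x ", " y "⟫" => inner ℝ x y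

/-- The linear map that rotates the plane spanned by the orthonormal vectors `u` and `w` by the
angle with cosine `c` and sine `s`, and fixes its orthogonal complement. -/
def planeRotationLinear (u w : E) (c s : ℝ) : E →ₗ[ℝ] E :=
  LinearMap.id + (((c - 1) • innerₛₗ ℝ u - s • innerₛₗ ℝ w).smulRight u +
    (s • innerₛₗ ℝ u + (c - 1) • innerₛₗ ℝ w).smulRight w)

theorem planeRotationLinear_apply (u w : E) (c s : ℝ) (v : E) :
    planeRotationLinear u w c s v = v + (((c - 1) * ⟪u, v⟫ - s * ⟪w, v⟫) • u +
      (s * ⟪u, v⟫ + (c - 1) * ⟪w, v⟫) • w) := by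
  simp [planeRotationLinear]

theorem norm_planeRotationLinear {u w : E} (hu : ‖u‖ = 1) (hw : ‖w‖ = 1) (huw : ⟪u, w⟫ = 0)
    {c s : ℝ} (hcs : c ^ 2 + s ^ 2 = 1) (v : E) : ‖planeRotationLinear u w c s v‖ = ‖v‖ := by
  have huu : ⟪u, u⟫ = 1 := by rw [real_inner_self_eq_norm_sq, hu, one_pow]
  have hww : ⟪w, w⟫ = 1 := by rw [real_inner_self_eq_norm_sq, hw, one_pow]
  have hwu : ⟪w, u⟫ = 0 := by rw [real_inner_comm, huw]
  rw [← sq_eq_sq₀ (norm_nonneg _) (norm_nonneg _), ← real_inner_self_eq_norm_sq,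
    ← real_inner_self_eq_norm_sq, planeRotationLinear_apply]
  simp only [inner_add_left, inner_add_right, real_inner_smul_left, real_inner_smul_right,
    huu, hww, huw, hwu, real_inner_comm u v, real_inner_comm w v]
  linear_combination (⟪u, v⟫ ^ 2 + ⟪w, v⟫ ^ 2) * hcs

/-- The rotation by the angle `θ` in the plane spanned by the orthonormal vectors `u` and `w`. -/
def planeRotation [FiniteDimensional ℝ E] {u w : E} (hu : ‖u‖ = 1) (hw : ‖w‖ = 1)
    (huw : ⟪u, w⟫ = 0) (θ : ℝ) : E ≃ₗᵢ[ℝ] E :=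
  -- In finite dimension an isometric endomorphism is onto; `rfl` is the equality of dimensions.
  LinearIsometry.toLinearIsometryEquiv
    ⟨planeRotationLinear u w (Real.cos θ) (Real.sin θ),
      norm_planeRotationLinear hu hw huw (Real.cos_sq_add_sin_sq θ)⟩ rfl

variable [FiniteDimensional ℝ E] {u w : E} (hu : ‖u‖ = 1) (hw : ‖w‖ = 1) (huw : ⟪u, w⟫ = 0)

theorem planeRotation_apply (θ : ℝ) (v : E) :
    planeRotation hu hw huw θ v =
      v + (((Real.cos θ - 1) * ⟪u, v⟫ - Real.sin θ * ⟪w, v⟫) • u +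
        (Real.sin θ * ⟪u, v⟫ + (Real.cos θ - 1) * ⟪w, v⟫) • w) :=
  planeRotationLinear_apply u w _ _ v

theorem inner_planeRotation_fst (θ : ℝ) (v : E) :
    ⟪u, planeRotation hu hw huw θ v⟫ = Real.cos θ * ⟪u, v⟫ - Real.sin θ * ⟪w, v⟫ := by
  have huu : ⟪u, u⟫ = 1 := by rw [real_inner_self_eq_norm_sq, hu, one_pow]
  rw [planeRotation_apply]
  simp only [inner_add_right, real_inner_smul_right, huu, huw]
  ring

theorem inner_planeRotation_snd (θ : ℝ) (v : E) :
    ⟪w, planeRotation hu hw huw θ v⟫ = Real.sin θ * ⟪u, v⟫ + Real.cos θ * ⟪w, v⟫ := by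
  have hww : ⟪w, w⟫ = 1 := by rw [real_inner_self_eq_norm_sq, hw, one_pow]
  have hwu : ⟪w, u⟫ = 0 := by rw [real_inner_comm, huw]
  rw [planeRotation_apply]
  simp only [inner_add_right, real_inner_smul_right, hww, hwu]
  ring

theorem inner_planeRotation_of_orthogonal (θ : ℝ) (v : E) {z : E} (hzu : ⟪z, u⟫ = 0)
    (hzw : ⟪z, w⟫ = 0) : ⟪z, planeRotation hu hw huw θ v⟫ = ⟪z, v⟫ := by
  rw [planeRotation_apply]
  simp [inner_add_right, real_inner_smul_right, hzu, hzw]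

end Rotation

/-! ### Rotation invariance of the uniform measure on the sphere -/

section Sphere

variable {E : Type*} [NormedAddCommGroup E] [InnerProductSpace ℝ E]

/-- The action of a linear isometry on the unit sphere. -/
def sphereMap (e : E ≃ₗᵢ[ℝ] E) (v : Metric.sphere (0 : E) 1) : Metric.sphere (0 : E) 1 :=
  ⟨e v, by simp⟩

theorem continuous_sphereMap (e : E ≃ₗᵢ[ℝ] E) : Continuous (sphereMap e) :=
  (e.continuous.comp continuous_subtype_val).subtype_mk _

variable [FiniteDimensional ℝ E] [MeasurableSpace E] [BorelSpace E]

open scoped Pointwise in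
-- The surface measure of a set is a multiple of the volume of the open cone over it. An isometry
-- carries cones to cones and preserves volume.
theorem measurePreserving_sphereMap (e : E ≃ₗᵢ[ℝ] E) :
    MeasurePreserving (sphereMap e) (volume : Measure E).toSphere
      (volume : Measure E).toSphere := by
  refine ⟨(continuous_sphereMap e).measurable, ?_⟩
  ext s hs
  rw [Measure.map_apply (continuous_sphereMap e).measurable hs,
    Measure.toSphere_apply' _ ((continuous_sphereMap e).measurable hs),
    Measure.toSphere_apply' _ hs]
  congr 1
  have : (Set.Ioo (0 : ℝ) 1 • (Subtype.val '' (sphereMap e ⁻¹' s)) : Set E) =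
      e ⁻¹' (Set.Ioo (0 : ℝ) 1 • (Subtype.val '' s)) := by
    ext x
    simp only [Set.mem_smul, Set.mem_image, Set.mem_preimage]
    constructor
    · rintro ⟨r, hr, _, ⟨v, hv, rfl⟩, rfl⟩
      exact ⟨r, hr, _, ⟨_, hv, rfl⟩, by simp [sphereMap]⟩
    · rintro ⟨r, hr, _, ⟨v, hv, rfl⟩, hx⟩
      refine ⟨r, hr, _, ⟨sphereMap e.symm v, ?_, rfl⟩, ?_⟩
      · simpa [sphereMap] using hv
      · apply e.injective
        simp [sphereMap, hx]
  rw [this]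
  exact e.measurePreserving.measure_preimage_emb e.toHomeomorph.measurableEmbedding _

end Sphere

theorem measurePreserving_sphereMap_unifSphere {n : ℕ}
    (e : EuclideanSpace ℝ (Fin n) ≃ₗᵢ[ℝ] EuclideanSpace ℝ (Fin n)) :
    MeasurePreserving (sphereMap e) (unifSphere n) (unifSphere n) :=
  (measurePreserving_sphereMap e).smul_measure _

theorem isProbabilityMeasure_unifSphere {n : ℕ} (hn : 0 < n) :
    IsProbabilityMeasure (unifSphere n) := by
  have : Nonempty (Fin n) := ⟨⟨0, hn⟩⟩
  refine ⟨?_⟩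
  rw [unifSphere, Measure.smul_apply, smul_eq_mul]
  refine ENNReal.inv_mul_cancel ?_ (measure_ne_top _ _)
  rw [Ne, Measure.measure_univ_eq_zero]
  exact Measure.toSphere_ne_zero _

/-! ### Quadratic forms on the sphere -/

/-- Differentiation under the integral sign; compactness of [-1,1] × S supplies the dominating
constant. -/
theorem integral_deriv_eq_zero_of_integral_const {S : Type*} [TopologicalSpace S] [CompactSpace S]
    [SecondCountableTopology S] [MeasurableSpace S] [OpensMeasurableSpace S] {μ : Measure S}
    [IsFiniteMeasure μ]
    {F F' : ℝ → S → ℝ} (hF : Continuous fun p : ℝ × S => F p.1 p.2)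
    (hF' : Continuous fun p : ℝ × S => F' p.1 p.2)
    (hd : ∀ θ v, HasDerivAt (fun θ => F θ v) (F' θ v) θ)
    (hconst : ∀ θ, ∫ v, F θ v ∂μ = ∫ v, F 0 v ∂μ) : ∫ v, F' 0 v ∂μ = 0 := by
  obtain ⟨C, hC⟩ := ((isCompact_Icc (a := (-1 : ℝ)) (b := 1)).prod
    (isCompact_univ (X := S))).exists_bound_of_continuousOn hF'.continuousOn
  have hcθ : ∀ θ, Continuous (F θ) := fun θ => hF.comp (Continuous.prodMk_right θ)
  have hder := (hasDerivAt_integral_of_dominated_loc_of_deriv_le (μ := μ) (F := F)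
    (F' := F') (x₀ := 0) (s := Set.Icc (-1) 1) (bound := fun _ => C)
    (Icc_mem_nhds (by norm_num) (by norm_num))
    (Filter.Eventually.of_forall fun θ => (hcθ θ).aestronglyMeasurable)
    ((hcθ 0).integrable_of_hasCompactSupport (HasCompactSupport.of_compactSpace _))
    (hF'.comp (Continuous.prodMk_right 0)).aestronglyMeasurable
    (Filter.Eventually.of_forall fun v θ hθ => hC (θ, v) ⟨hθ, Set.mem_univ v⟩)
    (integrable_const C)
    (Filter.Eventually.of_forall fun v θ _ => hd θ v)).2
  simp_rw [hconst] at hder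
  exact hder.unique (hasDerivAt_const _ _)

/-- The function `x y exp (t (p x² + q y² + r))` along the rotation of the `(x, y)`-plane. -/
def rotatedProduct (p q t x y r θ : ℝ) : ℝ :=
  (Real.cos θ * x - Real.sin θ * y) * (Real.sin θ * x + Real.cos θ * y) *
    Real.exp (t * (r + p * (Real.cos θ * x - Real.sin θ * y) ^ 2
      + q * (Real.sin θ * x + Real.cos θ * y) ^ 2))

/-- The derivative of `rotatedProduct` with respect to the angle. -/
def rotatedProductDeriv (p q t x y r θ : ℝ) : ℝ :=
  ((Real.cos θ * x - Real.sin θ * y) ^ 2 - (Real.sin θ * x + Real.cos θ * y) ^ 2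
    + 2 * t * (q - p) * ((Real.cos θ * x - Real.sin θ * y) *
      (Real.sin θ * x + Real.cos θ * y)) ^ 2) *
    Real.exp (t * (r + p * (Real.cos θ * x - Real.sin θ * y) ^ 2
      + q * (Real.sin θ * x + Real.cos θ * y) ^ 2))

theorem hasDerivAt_rotatedProduct (p q t x y r θ : ℝ) :
    HasDerivAt (rotatedProduct p q t x y r) (rotatedProductDeriv p q t x y r θ) θ := by
  have hA : HasDerivAt (fun θ => Real.cos θ * x - Real.sin θ * y)
      (-(Real.sin θ * x + Real.cos θ * y)) θ := by
    convert! ((Real.hasDerivAt_cos θ).mul_const x).sub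
      ((Real.hasDerivAt_sin θ).mul_const y) using 1
    ring
  have hD : HasDerivAt (fun θ => Real.sin θ * x + Real.cos θ * y)
      (Real.cos θ * x - Real.sin θ * y) θ := by
    convert! ((Real.hasDerivAt_sin θ).mul_const x).add
      ((Real.hasDerivAt_cos θ).mul_const y) using 1
    ring
  have hX := (((((hA.pow 2).const_mul p).const_add r).add
    ((hD.pow 2).const_mul q)).const_mul t).exp
  convert! (hA.mul hD).mul hX using 1
  simp only [rotatedProductDeriv, Pi.mul_apply, Pi.add_apply, Pi.pow_apply]
  push_cast
  ring

section QuadraticForm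

variable {n : ℕ} (b : OrthonormalBasis (Fin n) ℝ (EuclideanSpace ℝ (Fin n))) (β : Fin n → ℝ)

/-- The quadratic form with eigenvectors `b i` and eigenvalues `β i`. -/
def diagForm (v : EuclideanSpace ℝ (Fin n)) : ℝ := ∑ i, β i * inner ℝ (b i) v ^ 2

theorem continuous_diagForm : Continuous (diagForm b β) := by
  unfold diagForm; fun_prop

theorem sum_inner_sq_sphere (v : Metric.sphere (0 : EuclideanSpace ℝ (Fin n)) 1) :
    ∑ i, inner ℝ (b i) (v : EuclideanSpace ℝ (Fin n)) ^ 2 = 1 := by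
  have h := b.sum_sq_norm_inner_right (v : EuclideanSpace ℝ (Fin n))
  simpa using h

theorem diagForm_neg (v : EuclideanSpace ℝ (Fin n)) : diagForm b (-β) v = -diagForm b β v := by
  simp [diagForm]

theorem diagForm_planeRotation {i j : Fin n} (hij : i ≠ j) (θ : ℝ) (v : EuclideanSpace ℝ (Fin n)) :
    diagForm b β (planeRotation (b.norm_eq_one i) (b.norm_eq_one j) (b.inner_eq_zero hij) θ v) =
      diagForm b β v - β i * inner ℝ (b i) v ^ 2 - β j * inner ℝ (b j) v ^ 2
        + β i * (Real.cos θ * inner ℝ (b i) v - Real.sin θ * inner ℝ (b j) v) ^ 2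
        + β j * (Real.sin θ * inner ℝ (b i) v + Real.cos θ * inner ℝ (b j) v) ^ 2 := by
  classical
  -- Only the coordinates i and j change under the rotation, so they are split off from the sum.
  have key : ∀ g : Fin n → ℝ, ∑ k, g k = g i + g j + ∑ k ∈ (Finset.univ.erase i).erase j, g k := by
    intro g
    rw [← Finset.add_sum_erase _ _ (Finset.mem_univ i), ← Finset.add_sum_erase _ _
      (Finset.mem_erase.mpr ⟨hij.symm, Finset.mem_univ j⟩), add_assoc]
  unfold diagForm
  rw [key, key, inner_planeRotation_fst, inner_planeRotation_snd]
  have : ∀ k ∈ (Finset.univ.erase i).erase j, β k * inner ℝ (b k)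
      (planeRotation (b.norm_eq_one i) (b.norm_eq_one j) (b.inner_eq_zero hij) θ v) ^ 2 =
      β k * inner ℝ (b k) v ^ 2 := by
    intro k hk
    simp only [Finset.mem_erase] at hk
    rw [inner_planeRotation_of_orthogonal _ _ _ _ _ (b.inner_eq_zero hk.2.1)
      (b.inner_eq_zero hk.1)]
  rw [Finset.sum_congr rfl this]
  ring

/-- Infinitesimal rotation invariance. Along the rotation x' = -y and y' = x, so (xy)' = x² - y² and
Q' = 2(β_j - β_i)xy; the second supplies the term with t. -/
theorem integral_plane_identity (t : ℝ) {i j : Fin n} (hij : i ≠ j) :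
    ∫ v : Metric.sphere (0 : EuclideanSpace ℝ (Fin n)) 1,
      (inner ℝ (b i) v.1 ^ 2 - inner ℝ (b j) v.1 ^ 2 + 2 * t * (β j - β i) *
        (inner ℝ (b i) v.1 * inner ℝ (b j) v.1) ^ 2) * Real.exp (t * diagForm b β v)
      ∂(unifSphere n) = 0 := by
  have hn : 0 < n := i.pos
  have := isProbabilityMeasure_unifSphere hn
  have hcb := continuous_diagForm b β
  have h0 := integral_deriv_eq_zero_of_integral_const (μ := unifSphere n)
    (F := fun θ v => rotatedProduct (β i) (β j) t (inner ℝ (b i) v.1) (inner ℝ (b j) v.1)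
      (diagForm b β v - β i * inner ℝ (b i) v.1 ^ 2 - β j * inner ℝ (b j) v.1 ^ 2) θ)
    (F' := fun θ v => rotatedProductDeriv (β i) (β j) t (inner ℝ (b i) v.1) (inner ℝ (b j) v.1)
      (diagForm b β v - β i * inner ℝ (b i) v.1 ^ 2 - β j * inner ℝ (b j) v.1 ^ 2) θ)
    (by unfold rotatedProduct; fun_prop) (by unfold rotatedProductDeriv; fun_prop)
    (fun θ v => hasDerivAt_rotatedProduct _ _ _ _ _ _ θ) ?_
  · rw [← h0]
    refine integral_congr_ae (Filter.Eventually.of_forall fun v => ?_)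
    simp [rotatedProductDeriv]
    left; left; ring
  · intro θ
    have hmp := measurePreserving_sphereMap_unifSphere
      (planeRotation (b.norm_eq_one i) (b.norm_eq_one j) (b.inner_eq_zero hij) θ)
    conv_rhs => rw [← hmp.map_eq]
    rw [integral_map hmp.measurable.aemeasurable]
    · refine integral_congr_ae (Filter.Eventually.of_forall fun v => ?_)
      have hrot := diagForm_planeRotation b β hij θ v.1
      simp only [rotatedProduct, sphereMap, Real.cos_zero, Real.sin_zero, hrot,
        inner_planeRotation_fst, inner_planeRotation_snd]
      ring_nf
    · refine Continuous.aestronglyMeasurable ?_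
      unfold rotatedProduct; fun_prop

theorem integral_sphere_identity (t : ℝ) :
    ∫ v : Metric.sphere (0 : EuclideanSpace ℝ (Fin n)) 1,
      (∑ i, β i - n * diagForm b β v + 2 * t * (∑ i, β i ^ 2 * inner ℝ (b i) v.1 ^ 2
        - diagForm b β v ^ 2)) * Real.exp (t * diagForm b β v) ∂(unifSphere n) = 0 := by
  rcases Nat.eq_zero_or_pos n with rfl | hn
  · simp [diagForm]
  have := isProbabilityMeasure_unifSphere hn
  have hc := continuous_diagForm b β
  -- The weight β_j - β_i makes the double sum collapse: with ∑ x_i² = 1 the quadratic part becomes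
  -- 2(∑ β_i - nQ) and the quartic part twice the variance of β, up to the factor 2t. The diagonal
  -- terms carry weight 0.
  let G : Fin n → Fin n → Metric.sphere (0 : EuclideanSpace ℝ (Fin n)) 1 → ℝ := fun i j v =>
    (β j - β i) * ((inner ℝ (b i) v.1 ^ 2 - inner ℝ (b j) v.1 ^ 2 + 2 * t * (β j - β i) *
        (inner ℝ (b i) v.1 * inner ℝ (b j) v.1) ^ 2) * Real.exp (t * diagForm b β v))
  have hG : ∀ i j, ∫ v, G i j v ∂(unifSphere n) = 0 := by
    intro i j
    simp only [G]
    rw [integral_const_mul]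
    rcases eq_or_ne i j with rfl | hij
    · simp
    · rw [integral_plane_identity b β t hij, mul_zero]
  have hGi : ∀ i j, Integrable (G i j) (unifSphere n) := by
    intro i j
    refine Continuous.integrable_of_hasCompactSupport ?_ (HasCompactSupport.of_compactSpace _)
    simp only [G]; fun_prop
  have hsum : ∫ v, ∑ i, ∑ j, G i j v ∂(unifSphere n) = 0 := by
    rw [integral_finsetSum _ fun i _ => integrable_finsetSum _ fun j _ => hGi i j]
    refine Finset.sum_eq_zero fun i _ => ?_
    rw [integral_finsetSum _ fun j _ => hGi i j]
    exact Finset.sum_eq_zero fun j _ => hG i j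
  have heq : ∀ v : Metric.sphere (0 : EuclideanSpace ℝ (Fin n)) 1, ∑ i, ∑ j, G i j v =
      2 * ((∑ i, β i - n * diagForm b β v + 2 * t * (∑ i, β i ^ 2 * inner ℝ (b i) v.1 ^ 2
        - diagForm b β v ^ 2)) * Real.exp (t * diagForm b β v)) := by
    intro v
    have h1 := sum_inner_sq_sphere b v
    set x : Fin n → ℝ := fun i => inner ℝ (b i) v.1 with hx
    set e := Real.exp (t * diagForm b β v)
    have hform : diagForm b β v = ∑ i, β i * x i ^ 2 := rfl
    have h2 : ∀ i j, G i j v = (β j * x i ^ 2 - β j * x j ^ 2 - β i * x i ^ 2 + β i * x j ^ 2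
        + 2 * t * ((β j ^ 2 * x j ^ 2) * x i ^ 2 - 2 * ((β i * x i ^ 2) * (β j * x j ^ 2))
          + (β i ^ 2 * x i ^ 2) * x j ^ 2)) * e := by
      intro i j
      simp only [G, hx, e]; ring
    simp_rw [h2, ← Finset.sum_mul, Finset.sum_add_distrib, Finset.sum_sub_distrib, ← Finset.mul_sum,
      Finset.sum_add_distrib, Finset.sum_sub_distrib, ← Finset.mul_sum, ← Finset.sum_mul]
    change ∑ i, x i ^ 2 = 1 at h1
    change _ = 2 * ((∑ i, β i - n * diagForm b β v + 2 * t * (∑ i, β i ^ 2 * x i ^ 2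
        - diagForm b β v ^ 2)) * e)
    rw [hform, h1]
    simp only [Finset.sum_const, Finset.card_univ, Fintype.card_fin, nsmul_eq_mul, mul_assoc,
      ← Finset.mul_sum, h1]
    simp_rw [fun k => mul_left_comm (β k) (n : ℝ) (x k ^ 2), ← Finset.mul_sum]
    ring
  simp_rw [heq] at hsum
  rw [integral_const_mul] at hsum
  simpa using hsum

/-- The Bhatia–Davis variance bound: average (hi - β_i)(β_i - lo) ≥ 0 with the weights x_i², which
sum to 1. -/
theorem sum_sq_mul_sub_sq_le {lo hi : ℝ} (hβ : ∀ i, β i ∈ Set.Icc lo hi)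
    (v : Metric.sphere (0 : EuclideanSpace ℝ (Fin n)) 1) :
    ∑ i, β i ^ 2 * inner ℝ (b i) v.1 ^ 2 - diagForm b β v ^ 2 ≤
      (hi - diagForm b β v) * (diagForm b β v - lo) := by
  have h1 := sum_inner_sq_sphere b v
  have h2 : 0 ≤ ∑ i, (hi - β i) * (β i - lo) * inner ℝ (b i) v.1 ^ 2 :=
    Finset.sum_nonneg fun i _ => mul_nonneg (mul_nonneg (sub_nonneg.mpr (hβ i).2)
      (sub_nonneg.mpr (hβ i).1)) (sq_nonneg _)
  have h3 : ∑ i, (hi - β i) * (β i - lo) * inner ℝ (b i) v.1 ^ 2 =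
      (hi + lo) * diagForm b β v - hi * lo * ∑ i, inner ℝ (b i) v.1 ^ 2
        - ∑ i, β i ^ 2 * inner ℝ (b i) v.1 ^ 2 := by
    rw [diagForm, Finset.mul_sum, Finset.mul_sum, ← Finset.sum_sub_distrib,
      ← Finset.sum_sub_distrib]
    exact Finset.sum_congr rfl fun i _ => by ring
  rw [h3, h1] at h2
  linarith

theorem mgf_diagForm_le (hn : 0 < n) {lo hi : ℝ} (hβ : ∀ i, β i ∈ Set.Icc lo hi) {t : ℝ}
    (ht : 0 ≤ t) :
    mgf (fun v : Metric.sphere (0 : EuclideanSpace ℝ (Fin n)) 1 =>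
        diagForm b β v - (n : ℝ)⁻¹ * ∑ i, β i) (unifSphere n) t ≤
      Real.exp ((hi - lo) ^ 2 / (2 * (n + 2)) * t ^ 2 / 2) := by
  have := isProbabilityMeasure_unifSphere hn
  have hn0 : (0 : ℝ) < n := by exact_mod_cast hn
  have hc := continuous_diagForm b β
  set m := (n : ℝ)⁻¹ * ∑ i, β i with hm
  -- Centred at the midpoint, (hi - Q)(Q - lo) = K - (Y - δ)² with Y = Q - m and K = (hi - lo)²/4,
  -- the form needed for the moment inequality.
  set δ := (hi + lo) / 2 - m with hδ
  have hint : ∀ f : Metric.sphere (0 : EuclideanSpace ℝ (Fin n)) 1 → ℝ, Continuous f →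
      Integrable f (unifSphere n) := fun f hf =>
    hf.integrable_of_hasCompactSupport (HasCompactSupport.of_compactSpace _)
  have hmain := mgf_le_exp_of_moment_inequality (μ := unifSphere n)
    (Y := fun v => diagForm b β v - m) (n := n) (K := (hi - lo) ^ 2 / 4) (δ := δ)
    (fun t => hint _ (by fun_prop)) hn0 ?_ ht
  · convert! hmain using 3
    congr 1
    field_simp
    ring
  intro t ht
  have hid := integral_sphere_identity b β t
  have hexp : ∀ v : Metric.sphere (0 : EuclideanSpace ℝ (Fin n)) 1,
      Real.exp (t * diagForm b β v) =
        Real.exp (t * m) * Real.exp (t * (diagForm b β v - m)) := fun v => by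
    rw [← Real.exp_add]; congr 1; ring
  have hid' : ∫ v : Metric.sphere (0 : EuclideanSpace ℝ (Fin n)) 1,
      (∑ i, β i - n * diagForm b β v + 2 * t * (∑ i, β i ^ 2 * inner ℝ (b i) v.1 ^ 2
        - diagForm b β v ^ 2)) * Real.exp (t * (diagForm b β v - m)) ∂(unifSphere n) = 0 := by
    have h1 : ∀ v : Metric.sphere (0 : EuclideanSpace ℝ (Fin n)) 1,
      (∑ i, β i - n * diagForm b β v + 2 * t * (∑ i, β i ^ 2 * inner ℝ (b i) v.1 ^ 2
        - diagForm b β v ^ 2)) * Real.exp (t * diagForm b β v) = Real.exp (t * m) *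
      ((∑ i, β i - n * diagForm b β v + 2 * t * (∑ i, β i ^ 2 * inner ℝ (b i) v.1 ^ 2
        - diagForm b β v ^ 2)) * Real.exp (t * (diagForm b β v - m))) := fun v => by
      rw [hexp v]; ring
    simp_rw [h1] at hid
    rw [integral_const_mul] at hid
    exact (mul_eq_zero.mp hid).resolve_left (Real.exp_pos _).ne'
  have hle : 0 ≤ ∫ v : Metric.sphere (0 : EuclideanSpace ℝ (Fin n)) 1,
      ((2 * t * ((hi - lo) ^ 2 / 4 - δ ^ 2)) * Real.exp (t * (diagForm b β v - m))
        + (4 * t * δ - n) * ((diagForm b β v - m) * Real.exp (t * (diagForm b β v - m)))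
        - 2 * t * ((diagForm b β v - m) ^ 2 * Real.exp (t * (diagForm b β v - m))))
        ∂(unifSphere n) := by
    rw [← hid']
    refine integral_mono (hint _ (by fun_prop)) (hint _ (by fun_prop)) fun v => ?_
    have h1 := sum_sq_mul_sub_sq_le b β hβ v
    have h2 : ∑ i, β i = n * m := by rw [hm]; field_simp
    have h3 := mul_le_mul_of_nonneg_right (mul_le_mul_of_nonneg_left h1
      (by positivity : 0 ≤ 2 * t)) (Real.exp_pos (t * (diagForm b β v - m))).le
    simp only [h2, hδ]
    linarith
  rw [integral_sub (hint _ (by fun_prop)) (hint _ (by fun_prop)),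
    integral_add (hint _ (by fun_prop)) (hint _ (by fun_prop)), integral_const_mul,
    integral_const_mul, integral_const_mul] at hle
  simp only [mgf]
  linarith

/-- A quadratic form with eigenvalues in `[lo, hi]`, evaluated at a uniformly distributed unit
vector, is sub-Gaussian. -/
theorem hasSubgaussianMGF_diagForm (hn : 0 < n) {lo hi : ℝ} (hβ : ∀ i, β i ∈ Set.Icc lo hi) :
    HasSubgaussianMGF (fun v : Metric.sphere (0 : EuclideanSpace ℝ (Fin n)) 1 =>
        diagForm b β v - (n : ℝ)⁻¹ * ∑ i, β i)
      (Real.toNNReal ((hi - lo) ^ 2 / (2 * (n + 2)))) (unifSphere n) := by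
  have := isProbabilityMeasure_unifSphere hn
  have hc := continuous_diagForm b β
  refine ⟨fun t => Continuous.integrable_of_hasCompactSupport (by fun_prop)
    (HasCompactSupport.of_compactSpace _), fun t => ?_⟩
  rw [Real.coe_toNNReal _ (by positivity)]
  rcases le_total 0 t with ht | ht
  · exact mgf_diagForm_le b β hn hβ ht
  -- Negative t: pass to -Q, whose eigenvalues lie in [-hi, -lo], an interval of the same length.
  · have h := mgf_diagForm_le b (-β) hn (lo := -hi) (hi := -lo)
      (fun i => ⟨neg_le_neg (hβ i).2, neg_le_neg (hβ i).1⟩) (neg_nonneg.mpr ht)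
    convert! h using 1
    · simp only [mgf, diagForm_neg, Pi.neg_apply, Finset.sum_neg_distrib]
      refine integral_congr_ae (Filter.Eventually.of_forall fun v => ?_)
      simp only
      congr 1; ring
    · congr 1; ring

end QuadraticForm

/-! ### The spectral measures -/

section Spectral

variable {n : ℕ} {A : Matrix (Fin n) (Fin n) ℂ} (hA : A.IsHermitian)

theorem norm_toComplex (v : EuclideanSpace ℝ (Fin n)) : ‖toComplex v‖ = ‖v‖ := by
  simp [toComplex, EuclideanSpace.norm_eq]

theorem sum_norm_inner_eigenvectorBasis_sq (v : EuclideanSpace ℝ (Fin n)) :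
    ∑ i, ‖inner ℂ (toComplex v) (hA.eigenvectorBasis i)‖ ^ 2 = ‖v‖ ^ 2 := by
  rw [hA.eigenvectorBasis.sum_sq_norm_inner_left, norm_toComplex]

/-- The measure consists of finitely many atoms of finite mass, so no regularity of the integrand is
needed. -/
theorem integrable_weightedCESM (v : EuclideanSpace ℝ (Fin n)) (g : ℝ → ℝ) :
    Integrable g (weightedCESM hA v) := by
  rw [weightedCESM, integrable_finsetSum_measure]
  exact fun i _ => (integrable_dirac (by simp)).smul_measure ENNReal.ofReal_ne_top

theorem integral_weightedCESM (v : EuclideanSpace ℝ (Fin n)) (g : ℝ → ℝ) :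
    ∫ x, g x ∂(weightedCESM hA v) =
      ∑ i, ‖inner ℂ (toComplex v) (hA.eigenvectorBasis i)‖ ^ 2 * g (hA.eigenvalues i) := by
  rw [weightedCESM, integral_finsetSum_measure]
  · refine Finset.sum_congr rfl fun i _ => ?_
    rw [integral_smul_measure, integral_dirac, ENNReal.toReal_ofReal (by positivity), smul_eq_mul]
  · exact fun i _ => (integrable_dirac (by simp)).smul_measure ENNReal.ofReal_ne_top

theorem isProbabilityMeasure_weightedCESM {v : EuclideanSpace ℝ (Fin n)} (hv : ‖v‖ = 1) :
    IsProbabilityMeasure (weightedCESM hA v) := by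
  refine ⟨?_⟩
  simp only [weightedCESM, Measure.finsetSum_apply, Measure.smul_apply, measure_univ, smul_eq_mul,
    mul_one]
  rw [← ENNReal.ofReal_sum_of_nonneg fun _ _ => by positivity,
    sum_norm_inner_eigenvectorBasis_sq, hv]
  simp

theorem weightedCESM_compl_eq_zero {s : Set ℝ} (hs : ∀ i, hA.eigenvalues i ∈ s)
    (v : EuclideanSpace ℝ (Fin n)) : weightedCESM hA v sᶜ = 0 := by
  simp [weightedCESM, Measure.finsetSum_apply, hs]

theorem trace_cfc (f : ℝ → ℝ) :
    (hA.cfc f).trace = ((∑ i, f (hA.eigenvalues i) : ℝ) : ℂ) := by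
  rw [Matrix.IsHermitian.cfc, Unitary.conjStarAlgAut_apply, Matrix.trace_mul_cycle,
    Unitary.coe_star_mul_self, Matrix.one_mul, Matrix.trace_diagonal]
  simp

end Spectral

/-! ### Integration against averaged measures -/

section Averages

theorem integrable_avgMeasure {nv : ℕ} (hnv : 0 < nv) {Ψ : Fin nv → Measure ℝ} {g : ℝ → ℝ}
    (hg : ∀ l, Integrable g (Ψ l)) : Integrable g (avgMeasure Ψ) := by
  refine Integrable.smul_measure ?_ (by simp [hnv.ne'])
  rw [integrable_finsetSum_measure]
  exact fun l _ => hg l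

theorem integral_avgMeasure {nv : ℕ} {Ψ : Fin nv → Measure ℝ} {g : ℝ → ℝ}
    (hg : ∀ l, Integrable g (Ψ l)) :
    ∫ x, g x ∂(avgMeasure Ψ) = (nv : ℝ)⁻¹ * ∑ l, ∫ x, g x ∂(Ψ l) := by
  rw [avgMeasure, integral_smul_measure, integral_finsetSum_measure fun l _ => hg l]
  simp

end Averages

/-! ### Diagonalization of real quadratic forms -/

theorem exists_diagForm_eq_of_isSymm {n : ℕ} (B : Matrix (Fin n) (Fin n) ℝ) (hB : B.IsHermitian) :
    ∃ (b : OrthonormalBasis (Fin n) ℝ (EuclideanSpace ℝ (Fin n))) (β : Fin n → ℝ),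
      (∀ v : EuclideanSpace ℝ (Fin n), ∑ j, ∑ k, v j * B j k * v k = diagForm b β v) ∧
      ∑ i, β i = B.trace := by
  refine ⟨hB.eigenvectorBasis, hB.eigenvalues, fun v => ?_, ?_⟩
  · set T := Matrix.toEuclideanLin B with hT
    have hsymm : T.IsSymmetric := Matrix.isSymmetric_toEuclideanLin_iff.mpr hB
    have h1 : ∑ j, ∑ k, v j * B j k * v k = inner ℝ v (T v) := by
      simp only [PiLp.inner_apply, hT, Matrix.toLpLin_apply, Matrix.mulVec, dotProduct]
      refine Finset.sum_congr rfl fun j _ => ?_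
      simp only [RCLike.inner_apply, conj_trivial, Finset.sum_mul]
      exact Finset.sum_congr rfl fun k _ => by ring
    rw [h1, ← hB.eigenvectorBasis.sum_inner_mul_inner v (T v), diagForm]
    refine Finset.sum_congr rfl fun i _ => ?_
    have h2 : T (hB.eigenvectorBasis i) = hB.eigenvalues i • hB.eigenvectorBasis i := by
      have := hB.mulVec_eigenvectorBasis i
      ext j
      simpa [hT, Matrix.toLpLin_apply] using congrFun this j
    rw [← hsymm, h2, real_inner_smul_left, real_inner_comm v]
    ring
  · have := hB.trace_eq_sum_eigenvalues
    simpa using this.symm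

/-- A real vector sees only the real part of the Hermitian matrix f(A). That part is real symmetric,
so it has a real orthonormal eigenbasis, and its trace is still tr f(A) because the diagonal of f(A)
is real. -/
theorem exists_diagForm_eq_integral {n : ℕ} {A : Matrix (Fin n) (Fin n) ℂ} (hA : A.IsHermitian)
    (f : ℝ → ℝ) :
    ∃ (b : OrthonormalBasis (Fin n) ℝ (EuclideanSpace ℝ (Fin n))) (β : Fin n → ℝ),
      (∀ v, ∫ x, f x ∂(weightedCESM hA v) = diagForm b β v) ∧
      ∑ i, β i = ∑ i, f (hA.eigenvalues i) := by
  set u := hA.eigenvectorBasis with hu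
  set F : Fin n → ℝ := fun i => f (hA.eigenvalues i) with hF
  -- The entries are the real parts of those of ∑ f(λ_i) u_i u_iᴴ.
  let B : Matrix (Fin n) (Fin n) ℝ := Matrix.of fun j k =>
    ∑ i, F i * ((u i j).re * (u i k).re + (u i j).im * (u i k).im)
  have hB : B.IsHermitian := by
    ext j k
    simp only [Matrix.conjTranspose_apply, B, Matrix.of_apply, star_trivial]
    exact Finset.sum_congr rfl fun i _ => by ring
  obtain ⟨b, β, h1, h2⟩ := exists_diagForm_eq_of_isSymm B hB
  refine ⟨b, β, fun v => ?_, ?_⟩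
  · rw [integral_weightedCESM, ← h1, ← hu]
    have h3 : ∀ i, ‖inner ℂ (toComplex v) (u i)‖ ^ 2 =
        ∑ j, ∑ k, v j * ((u i j).re * (u i k).re + (u i j).im * (u i k).im) * v k := by
      intro i
      have h4 : inner ℂ (toComplex v) (u i) =
          ⟨∑ j, v j * (u i j).re, ∑ j, v j * (u i j).im⟩ := by
        apply Complex.ext <;>
        simp [PiLp.inner_apply, toComplex, mul_comm]
      rw [h4, Complex.sq_norm, Complex.normSq_mk, Finset.sum_mul_sum, Finset.sum_mul_sum,
        ← Finset.sum_add_distrib]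
      refine Finset.sum_congr rfl fun j _ => ?_
      rw [← Finset.sum_add_distrib]
      exact Finset.sum_congr rfl fun k _ => by ring
    simp only [B, Matrix.of_apply, h3, Finset.mul_sum, Finset.sum_mul]
    rw [Finset.sum_comm]
    refine Finset.sum_congr rfl fun j _ => ?_
    rw [Finset.sum_comm]
    refine Finset.sum_congr rfl fun k _ => Finset.sum_congr rfl fun i _ => ?_
    simp only [hF]; ring
  · rw [h2]
    simp only [Matrix.trace, Matrix.diag_apply, B, Matrix.of_apply]
    rw [Finset.sum_comm]
    refine Finset.sum_congr rfl fun i _ => ?_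
    rw [← Finset.mul_sum]
    have h5 : ‖u i‖ ^ 2 = 1 := by rw [u.norm_eq_one, one_pow]
    rw [EuclideanSpace.norm_sq_eq] at h5
    have h6 : ∑ j, ((u i j).re * (u i j).re + (u i j).im * (u i j).im) = 1 := by
      rw [← h5]
      refine Finset.sum_congr rfl fun j _ => ?_
      rw [Complex.sq_norm, Complex.normSq_apply]
    rw [h6, mul_one]

theorem diagForm_apply_basis {n : ℕ} (b : OrthonormalBasis (Fin n) ℝ (EuclideanSpace ℝ (Fin n)))
    (β : Fin n → ℝ) (i : Fin n) : diagForm b β (b i) = β i := by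
  classical
  simp [diagForm, OrthonormalBasis.inner_eq_ite]

theorem integral_mem_Icc_of_supported {ν : Measure ℝ} [IsProbabilityMeasure ν] {a b lo hi : ℝ}
    (hν : ν (Set.Icc a b)ᶜ = 0) {g : ℝ → ℝ} (hg : Integrable g ν)
    (h : ∀ x ∈ Set.Icc a b, g x ∈ Set.Icc lo hi) : ∫ x, g x ∂ν ∈ Set.Icc lo hi := by
  have hae : ∀ᵐ x ∂ν, x ∈ Set.Icc a b := hν
  constructor
  · have := integral_mono_ae (integrable_const lo) hg (hae.mono fun x hx => (h x hx).1)
    simpa using this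
  · have := integral_mono_ae hg (integrable_const hi) (hae.mono fun x hx => (h x hx).2)
    simpa using this

theorem abs_integral_le_of_supported {ν : Measure ℝ} [IsProbabilityMeasure ν] {a b M : ℝ}
    (hν : ν (Set.Icc a b)ᶜ = 0) {g : ℝ → ℝ} (hg : Integrable g ν)
    (h : ∀ x ∈ Set.Icc a b, |g x| ≤ M) : |∫ x, g x ∂ν| ≤ M :=
  abs_le.mpr (integral_mem_Icc_of_supported hν hg fun x hx => abs_le.mp (h x hx))

/-! ### Concentration of the averaged spectral measures -/

theorem measure_abs_integral_avgMeasure_sub_le {n nv : ℕ} (hn : 0 < n) (hnv : 0 < nv)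
    {A : Matrix (Fin n) (Fin n) ℂ} (hA : A.IsHermitian) {a b : ℝ}
    (hspec : ∀ i, hA.eigenvalues i ∈ Set.Icc a b) {f : ℝ → ℝ} {lo hi : ℝ}
    (hf : ∀ x ∈ Set.Icc a b, f x ∈ Set.Icc lo hi) (hlt : lo < hi)
    {Ω : Type*} [MeasurableSpace Ω] {P : Measure Ω} [IsProbabilityMeasure P]
    {v : Fin nv → Ω → Metric.sphere (0 : EuclideanSpace ℝ (Fin n)) 1}
    (hlaw : ∀ l, HasLaw (v l) (unifSphere n) P) (hindep : iIndepFun v P) {ε : ℝ} (hε : 0 < ε) :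
    P.real {ω | ε ≤ |∫ x, f x ∂(avgMeasure fun l => weightedCESM hA (v l ω)) -
        (n : ℝ)⁻¹ * ∑ i, f (hA.eigenvalues i)|} ≤
      2 * Real.exp (-(nv * (n + 2) * ε ^ 2 / (hi - lo) ^ 2)) := by
  obtain ⟨b', β, hform, htr⟩ := exists_diagForm_eq_integral hA f
  -- The eigenvalue β_i is the form at b_i, that is, the integral of f against the spectral measure
  -- of the unit vector b_i.
  have hβ : ∀ i, β i ∈ Set.Icc lo hi := by
    intro i
    have := isProbabilityMeasure_weightedCESM hA (b'.norm_eq_one i)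
    rw [← diagForm_apply_basis b' β i, ← hform]
    exact integral_mem_Icc_of_supported (weightedCESM_compl_eq_zero hA hspec _)
      (integrable_weightedCESM hA _ f) hf
  set m := (n : ℝ)⁻¹ * ∑ i, β i with hm
  have hnv0 : (0 : ℝ) < nv := by exact_mod_cast hnv
  have hR : 0 < hi - lo := sub_pos.mpr hlt
  have hsub := hasSubgaussianMGF_diagForm b' β hn hβ
  have hc := continuous_diagForm b' β
  set κ := Real.toNNReal ((hi - lo) ^ 2 / (2 * (n + 2))) with hκ
  let X : Fin nv → Ω → ℝ := fun l ω => diagForm b' β (v l ω) - m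
  have hX : ∀ l, HasSubgaussianMGF (X l) κ P := by
    intro l
    refine HasSubgaussianMGF.of_map (Y := v l)
      (X := fun w : Metric.sphere (0 : EuclideanSpace ℝ (Fin n)) 1 => diagForm b' β w - m)
      (hlaw l).aemeasurable ?_
    rw [(hlaw l).map_eq]
    exact hsub
  have hXi : iIndepFun X P := hindep.comp
    (fun _ (w : Metric.sphere (0 : EuclideanSpace ℝ (Fin n)) 1) => diagForm b' β w - m)
    fun _ => Continuous.measurable (by fun_prop)
  have hXn : iIndepFun (fun l => -X l) P := hindep.comp
    (fun _ (w : Metric.sphere (0 : EuclideanSpace ℝ (Fin n)) 1) => -(diagForm b' β w - m))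
    fun _ => Continuous.measurable (by fun_prop)
  -- Chernoff exponent for the sum of nv terms, each with proxy κ, at the level nv ε: (nv ε)²/(2 nv
  -- κ).
  have hexp : -(nv * ε) ^ 2 / (2 * ((∑ _l : Fin nv, κ : NNReal) : ℝ)) =
      -(nv * (n + 2) * ε ^ 2 / (hi - lo) ^ 2) := by
    have : (κ : ℝ) = (hi - lo) ^ 2 / (2 * (n + 2)) := Real.coe_toNNReal _ (by positivity)
    simp [this]
    field_simp
  have h1 := HasSubgaussianMGF.measure_sum_ge_le_of_iIndepFun hXi (s := Finset.univ)
    (fun l _ => hX l) (ε := nv * ε) (by positivity)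
  have h2 := HasSubgaussianMGF.measure_sum_ge_le_of_iIndepFun hXn (s := Finset.univ)
    (fun l _ => (hX l).neg) (ε := nv * ε) (by positivity)
  rw [hexp] at h1 h2
  refine (measureReal_mono (s₂ := {ω | nv * ε ≤ ∑ l, X l ω} ∪ {ω | nv * ε ≤ ∑ l, (-X l) ω})
    ?_ (measure_ne_top _ _)).trans ((measureReal_union_le _ _).trans ?_)
  · intro ω hω
    simp only [Set.mem_ofPred_eq] at hω
    rw [integral_avgMeasure (fun l => integrable_weightedCESM hA _ f), ← htr, ← hm] at hω
    have h3 : (nv : ℝ)⁻¹ * ∑ l, ∫ x, f x ∂(weightedCESM hA (v l ω)) - m =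
        (nv : ℝ)⁻¹ * ∑ l, X l ω := by
      simp only [X, hform, Finset.sum_sub_distrib, Finset.sum_const, Finset.card_univ,
        Fintype.card_fin, nsmul_eq_mul]
      field_simp
    rw [h3, le_abs] at hω
    rcases hω with h | h
    · left
      rw [inv_mul_eq_div, le_div_iff₀ hnv0] at h
      simpa [mul_comm] using h
    · right
      rw [← mul_neg, inv_mul_eq_div, le_div_iff₀ hnv0] at h
      simpa [mul_comm] using h
  · linarith

/-! ### Monic orthogonal polynomials -/

theorem degree_monicOrth_correction_lt (ν : Measure ℝ) (j : ℕ) :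
    (∑ i : Fin j, C ((∫ x, x ^ j * (monicOrth ν i).eval x ∂ν) /
      ∫ x, (monicOrth ν i).eval x ^ 2 ∂ν) * monicOrth ν i).degree < (j : WithBot ℕ) := by
  rw [← Polynomial.mem_degreeLT]
  refine Submodule.sum_mem _ fun i _ => ?_
  rw [← smul_eq_C_mul]
  refine Submodule.smul_mem _ _ ?_
  rw [Polynomial.mem_degreeLT]
  exact degree_le_natDegree.trans_lt
    (by exact_mod_cast (natDegree_monicOrth_le ν i).trans_lt i.2)

theorem monic_monicOrth (ν : Measure ℝ) (j : ℕ) : (monicOrth ν j).Monic := by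
  rw [monicOrth]
  exact (monic_X_pow j).sub_of_left
    ((degree_monicOrth_correction_lt ν j).trans_eq (degree_X_pow j).symm)

theorem degree_monicOrth (ν : Measure ℝ) (j : ℕ) : (monicOrth ν j).degree = j := by
  rw [monicOrth, degree_sub_eq_left_of_degree_lt, degree_X_pow]
  rw [degree_X_pow]
  exact degree_monicOrth_correction_lt ν j

theorem natDegree_monicOrth (ν : Measure ℝ) (j : ℕ) : (monicOrth ν j).natDegree = j :=
  natDegree_eq_of_degree_eq_some (degree_monicOrth ν j)

/-- The polynomial is a combination of the leading monic polynomial and a lower order term. -/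
theorem degree_sub_C_mul_monicOrth_lt (ν : Measure ℝ) {m : ℕ} {q : ℝ[X]}
    (hq : q.degree < ((m + 1 : ℕ) : WithBot ℕ)) :
    (q - C (q.coeff m) * monicOrth ν m).degree < (m : WithBot ℕ) := by
  rw [degree_lt_iff_coeff_zero]
  intro l hl
  have hlc : (monicOrth ν m).coeff m = 1 := by
    have := (monic_monicOrth ν m).coeff_natDegree
    rwa [natDegree_monicOrth] at this
  rcases hl.eq_or_lt with rfl | hlt
  · simp [hlc]
  · have h1 : q.coeff l = 0 := (degree_lt_iff_coeff_zero _ _).mp hq l hlt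
    have h2 : (monicOrth ν m).coeff l = 0 :=
      coeff_eq_zero_of_natDegree_lt (by rwa [natDegree_monicOrth])
    simp [h1, h2]

/-! ### Orthogonality, zeros of orthogonal polynomials and Gaussian exactness -/

section Orthogonality

variable {ν : Measure ℝ} (hint : ∀ p : ℝ[X], Integrable (fun x => p.eval x) ν)

/-- Integration of polynomials, as a linear functional. -/
def polyInt (hint : ∀ p : ℝ[X], Integrable (fun x => p.eval x) ν) : ℝ[X] →ₗ[ℝ] ℝ where
  toFun p := ∫ x, p.eval x ∂ν
  map_add' p q := by
    simp only [eval_add]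
    exact integral_add (hint p) (hint q)
  map_smul' c p := by
    simp only [eval_smul, RingHom.id_apply]
    exact integral_smul c _

theorem polyInt_apply (p : ℝ[X]) : polyInt hint p = ∫ x, p.eval x ∂ν := rfl

theorem polyInt_C_mul (c : ℝ) (p : ℝ[X]) : polyInt hint (C c * p) = c * polyInt hint p := by
  rw [← smul_eq_C_mul, map_smul, smul_eq_mul]

theorem polyInt_mul_self_nonneg (p : ℝ[X]) : 0 ≤ polyInt hint (p * p) := by
  rw [polyInt_apply]
  refine integral_nonneg fun x => ?_
  simp only [eval_mul]
  exact mul_self_nonneg _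

theorem ae_eq_zero_of_polyInt_mul_self {p : ℝ[X]} (h : polyInt hint (p * p) = 0) :
    ∀ᵐ x ∂ν, p.eval x = 0 := by
  rw [polyInt_apply, integral_eq_zero_iff_of_nonneg _ (hint _)] at h
  · filter_upwards [h] with x hx
    simpa using hx
  · intro x
    simp only [eval_mul]
    exact mul_self_nonneg _

/-- The orthogonal polynomials of degree less than `k` have nonzero norm. -/
def HasOrth (ν : Measure ℝ) (k : ℕ) : Prop := ∀ i < k, (∫ x, (monicOrth ν i).eval x ^ 2 ∂ν) ≠ 0

variable {k : ℕ} (hk : HasOrth ν k)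
include hint hk

/-- Gram–Schmidt: in the pairing with `monicOrth ν i` only the i-th correction survives, and it
cancels the pairing of X^j. The cancellation requires a nonzero norm, which `HasOrth` provides below
k. -/
theorem polyInt_monicOrth_mul_monicOrth {j : ℕ} (hj : j ≤ k) :
    ∀ i < j, polyInt hint (monicOrth ν j * monicOrth ν i) = 0 := by
  induction j using Nat.strong_induction_on with
  | _ j ih =>
    intro i hi
    have hN : ∀ l, (∫ x, (monicOrth ν l).eval x ^ 2 ∂ν) =
        polyInt hint (monicOrth ν l * monicOrth ν l) := fun l => by
      simp only [polyInt_apply, eval_mul, sq]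
    have hX : ∀ l, (∫ x, x ^ j * (monicOrth ν l).eval x ∂ν) =
        polyInt hint (X ^ j * monicOrth ν l) := fun l => by
      simp only [polyInt_apply, eval_mul, eval_pow, eval_X]
    rw [monicOrth, sub_mul, map_sub, Finset.sum_mul, map_sum]
    simp only [mul_assoc, polyInt_C_mul]
    rw [Finset.sum_eq_single (⟨i, hi⟩ : Fin j)]
    · rw [hX, hN, div_mul_cancel₀, sub_self]
      rw [← hN]
      exact hk i (hi.trans_le hj)
    · intro l _ hl
      have hl' : (l : ℕ) ≠ i := fun h => hl (Fin.ext h)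
      rcases lt_or_gt_of_ne hl' with h | h
      · rw [mul_comm (monicOrth ν l), ih i hi (hi.le.trans hj) l h, mul_zero]
      · rw [ih l l.2 (l.2.le.trans hj) i h, mul_zero]
    · exact fun h => absurd (Finset.mem_univ _) h

theorem polyInt_monicOrth_mul {j : ℕ} (hj : j ≤ k) {q : ℝ[X]} (hq : q.degree < (j : WithBot ℕ)) :
    polyInt hint (monicOrth ν j * q) = 0 := by
  have key : ∀ m ≤ j, ∀ q : ℝ[X], q.degree < (m : WithBot ℕ) →
      polyInt hint (monicOrth ν j * q) = 0 := by
    intro m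
    induction m with
    | zero =>
      intro _ q hq
      have : q = 0 := by
        rw [← degree_eq_bot]
        exact Nat.WithBot.lt_zero_iff.mp (by exact_mod_cast hq)
      simp [this]
    | succ m ih =>
      intro hm q hq
      have h1 := ih (by omega) _ (degree_sub_C_mul_monicOrth_lt ν hq)
      rw [mul_sub, map_sub, mul_left_comm, polyInt_C_mul,
        polyInt_monicOrth_mul_monicOrth hint hk hj m (by omega), mul_zero, sub_zero] at h1
      exact h1
  exact key j le_rfl q hq

/-- Split off the leading term, q = a π_d + r with deg r < d. The cross term vanishes by
orthogonality, leaving a² ‖π_d‖² + ‖r‖² with the first summand positive. -/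
theorem polyInt_mul_self_pos {q : ℝ[X]} (hq0 : q ≠ 0) (hq : q.degree < (k : WithBot ℕ)) :
    0 < polyInt hint (q * q) := by
  set d := q.natDegree with hd
  have hdk : d < k := by rwa [degree_eq_natDegree hq0, Nat.cast_lt] at hq
  set r := q - C (q.coeff d) * monicOrth ν d with hr
  have hrd : r.degree < (d : WithBot ℕ) := degree_sub_C_mul_monicOrth_lt ν (by
    rw [degree_eq_natDegree hq0]; exact_mod_cast Nat.lt_succ_self _)
  have ha : q.coeff d ≠ 0 := by rw [hd]; exact leadingCoeff_ne_zero.mpr hq0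
  have hN : 0 < polyInt hint (monicOrth ν d * monicOrth ν d) := by
    refine lt_of_le_of_ne (polyInt_mul_self_nonneg hint _) (Ne.symm ?_)
    have := hk d hdk
    simpa only [polyInt_apply, eval_mul, ← pow_two, eval_pow] using this
  have hqq : q * q = C (q.coeff d ^ 2) * (monicOrth ν d * monicOrth ν d)
      + C (2 * q.coeff d) * (monicOrth ν d * r) + r * r := by
    rw [hr, C_pow, C_mul, C_ofNat]; ring
  rw [hqq, map_add, map_add, polyInt_C_mul, polyInt_C_mul,
    polyInt_monicOrth_mul hint hk hdk.le hrd, mul_zero, add_zero]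
  have := polyInt_mul_self_nonneg hint r
  positivity

theorem eq_zero_of_ae_eval_eq_zero {q : ℝ[X]} (hq : q.degree < (k : WithBot ℕ))
    (h : ∀ᵐ x ∂ν, q.eval x = 0) : q = 0 := by
  by_contra hq0
  refine (polyInt_mul_self_pos hint hk hq0 hq).ne' ?_
  rw [polyInt_apply]
  refine integral_eq_zero_of_ae ?_
  filter_upwards [h] with x hx
  simp [hx]

/-- If a factor `g` of the orthogonal polynomial has constant sign, then the orthogonal polynomial
vanishes almost everywhere. -/
theorem ae_eval_eq_zero_of_factor {g q : ℝ[X]} (hgq : monicOrth ν k = g * q) (hg : 0 < g.natDegree)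
    (hsign : (∀ᵐ x ∂ν, 0 ≤ g.eval x) ∨ (∀ᵐ x ∂ν, g.eval x ≤ 0)) :
    ∀ᵐ x ∂ν, g.eval x * q.eval x ^ 2 = 0 := by
  have hp0 := (monic_monicOrth ν k).ne_zero
  have hg0 : g ≠ 0 := fun h => hp0 (by rw [hgq, h, zero_mul])
  have hq0 : q ≠ 0 := fun h => hp0 (by rw [hgq, h, mul_zero])
  have hdeg : q.degree < (k : WithBot ℕ) := by
    have := natDegree_mul hg0 hq0
    rw [← hgq, natDegree_monicOrth] at this
    rw [degree_eq_natDegree hq0, Nat.cast_lt]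
    omega
  -- The cofactor q has degree below k, so it is orthogonal to π_k = g q; thus g q² has integral 0
  -- and constant sign.
  have h0 : polyInt hint (g * q * q) = 0 := by
    rw [← hgq]; exact polyInt_monicOrth_mul hint hk le_rfl hdeg
  have heval : ∀ x, (g * q * q).eval x = g.eval x * q.eval x ^ 2 := fun x => by
    simp only [eval_mul]; ring
  rcases hsign with h | h
  · rw [polyInt_apply, integral_eq_zero_iff_of_nonneg_ae _ (hint _)] at h0
    · filter_upwards [h0] with x hx
      rw [← heval]; exact hx
    · filter_upwards [h] with x hx
      rw [heval]; exact mul_nonneg hx (sq_nonneg _)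
  · have h1 : polyInt hint (-(g * q * q)) = 0 := by rw [map_neg, h0, neg_zero]
    rw [polyInt_apply, integral_eq_zero_iff_of_nonneg_ae _ (hint _)] at h1
    · filter_upwards [h1] with x hx
      rw [← heval]
      simpa using hx
    · filter_upwards [h] with x hx
      rw [eval_neg, heval]
      exact neg_nonneg.mpr (mul_nonpos_of_nonpos_of_nonneg hx (sq_nonneg _))

/-- A factor of positive degree that has constant sign has a zero on every set of full measure. -/
theorem not_ae_eval_ne_zero_of_factor {g q : ℝ[X]} (hgq : monicOrth ν k = g * q)
    (hg : 0 < g.natDegree) (hsign : (∀ᵐ x ∂ν, 0 ≤ g.eval x) ∨ (∀ᵐ x ∂ν, g.eval x ≤ 0)) :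
    ¬ ∀ᵐ x ∂ν, g.eval x ≠ 0 := by
  intro hne
  have hp0 := (monic_monicOrth ν k).ne_zero
  have hg0 : g ≠ 0 := fun h => hp0 (by rw [hgq, h, zero_mul])
  have hq0 : q ≠ 0 := fun h => hp0 (by rw [hgq, h, mul_zero])
  have hdeg : q.degree < (k : WithBot ℕ) := by
    have := natDegree_mul hg0 hq0
    rw [← hgq, natDegree_monicOrth] at this
    rw [degree_eq_natDegree hq0, Nat.cast_lt]
    omega
  refine hq0 (eq_zero_of_ae_eval_eq_zero hint hk hdeg ?_)
  filter_upwards [hne, ae_eval_eq_zero_of_factor hint hk hgq hg hsign] with x hx h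
  exact pow_eq_zero_iff (two_ne_zero) |>.mp ((mul_eq_zero.mp h).resolve_left hx)

/-- For θ outside [a,b] the factor X - θ would have constant sign and no zero on [a,b]. -/
theorem mem_Icc_of_isRoot_monicOrth {a b : ℝ} (hsupp : ν (Set.Icc a b)ᶜ = 0) {θ : ℝ}
    (hθ : (monicOrth ν k).IsRoot θ) : θ ∈ Set.Icc a b := by
  have hae : ∀ᵐ x ∂ν, x ∈ Set.Icc a b := hsupp
  obtain ⟨q, hq⟩ := dvd_iff_isRoot.mpr hθ
  by_contra hmem
  refine not_ae_eval_ne_zero_of_factor hint hk hq (by simp) ?_ ?_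
  · rw [Set.mem_Icc, not_and_or, not_le, not_le] at hmem
    rcases hmem with h | h
    · left
      filter_upwards [hae] with x hx
      simp only [eval_sub, eval_X, eval_C]
      linarith [hx.1]
    · right
      filter_upwards [hae] with x hx
      simp only [eval_sub, eval_X, eval_C]
      linarith [hx.2]
  · filter_upwards [hae] with x hx
    simp only [eval_sub, eval_X, eval_C]
    intro h
    rw [sub_eq_zero.mp h] at hx
    exact hmem hx

/-- If (X - θ)² divided π_k with cofactor q, this nonnegative factor would force (X - θ) q to vanish
almost everywhere, although its degree is k - 1. -/
theorem nodup_roots_monicOrth : (monicOrth ν k).roots.Nodup := by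
  classical
  have hp0 := (monic_monicOrth ν k).ne_zero
  rw [Multiset.nodup_iff_count_le_one]
  intro θ
  rw [count_roots]
  by_contra hlt
  obtain ⟨q, hq⟩ := (le_rootMultiplicity_iff hp0).mp (by omega : 2 ≤ rootMultiplicity θ _)
  have hq0 : q ≠ 0 := fun h => hp0 (by rw [hq, h, mul_zero])
  have hae := ae_eval_eq_zero_of_factor hint hk hq (by simp)
    (Or.inl (Filter.Eventually.of_forall fun x => by
      simp only [eval_pow]; exact sq_nonneg _))
  have hr0 : (X - C θ) * q ≠ 0 := mul_ne_zero (X_sub_C_ne_zero θ) hq0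
  refine hr0 (eq_zero_of_ae_eval_eq_zero hint hk ?_ ?_)
  · have h1 := natDegree_mul (pow_ne_zero 2 (X_sub_C_ne_zero θ)) hq0
    rw [← hq, natDegree_monicOrth, natDegree_pow, natDegree_X_sub_C] at h1
    rw [degree_eq_natDegree hr0, natDegree_mul (X_sub_C_ne_zero θ) hq0, natDegree_X_sub_C,
      Nat.cast_lt]
    omega
  · filter_upwards [hae] with x hx
    rw [eval_pow, ← mul_pow] at hx
    rw [eval_mul]
    exact pow_eq_zero_iff two_ne_zero |>.mp hx

/-- The cofactor g left after removing all real roots has no real zero, so it has constant sign by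
the intermediate value theorem; hence it has degree 0. -/
theorem card_roots_monicOrth : (monicOrth ν k).roots.card = k := by
  obtain ⟨g, hg, hcard, hroots⟩ := exists_prod_multiset_X_sub_C_mul (monicOrth ν k)
  rw [natDegree_monicOrth] at hcard
  rcases Nat.eq_zero_or_pos g.natDegree with h0 | hpos
  · omega
  · exfalso
    have hg0 : g ≠ 0 := fun h => by simp [h] at hpos
    have hne : ∀ x, g.eval x ≠ 0 := fun x hx => by
      have : x ∈ g.roots := (mem_roots hg0).mpr hx
      simp [hroots] at this
    refine not_ae_eval_ne_zero_of_factor hint hk (hg.symm.trans (mul_comm _ _)) hpos ?_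
      (Filter.Eventually.of_forall hne)
    by_contra hcon
    rw [not_or] at hcon
    obtain ⟨x, hx⟩ : ∃ x, g.eval x < 0 := by
      by_contra h
      push Not at h
      exact hcon.1 (Filter.Eventually.of_forall h)
    obtain ⟨y, hy⟩ : ∃ y, 0 < g.eval y := by
      by_contra h
      push Not at h
      exact hcon.2 (Filter.Eventually.of_forall h)
    obtain ⟨z, hz⟩ := mem_range_of_exists_le_of_exists_ge g.continuous ⟨x, hx.le⟩ ⟨y, hy.le⟩
    exact hne z hz

theorem card_orthNodes : (orthNodes ν k).card = k := by
  rw [orthNodes, Multiset.toFinset_card_of_nodup (nodup_roots_monicOrth hint hk),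
    card_roots_monicOrth hint hk]

theorem orthNodes_subset_Icc {a b : ℝ} (hsupp : ν (Set.Icc a b)ᶜ = 0) {θ : ℝ}
    (hθ : θ ∈ orthNodes ν k) : θ ∈ Set.Icc a b :=
  mem_Icc_of_isRoot_monicOrth hint hk hsupp (isRoot_of_mem_roots (Multiset.mem_toFinset.mp hθ))

omit hint hk in
theorem nodeInterp_eq_self {t : Finset ℝ} {p : ℝ[X]} (hp : p.degree < (t.card : WithBot ℕ)) :
    nodeInterp t (fun x => p.eval x) = p :=
  (Lagrange.eq_interpolate_of_eval_eq _ Function.injective_id.injOn hp fun _ _ => rfl).symm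

omit hk in
theorem integral_nodeInterp (t : Finset ℝ) (f : ℝ → ℝ) :
    ∫ x, (nodeInterp t f).eval x ∂ν =
      ∑ θ ∈ t, f θ * ∫ x, (Lagrange.basis t id θ).eval x ∂ν := by
  rw [← polyInt_apply hint, nodeInterp, Lagrange.interpolate_apply, map_sum]
  exact Finset.sum_congr rfl fun θ _ => polyInt_C_mul hint _ _

/-- Interpolatory quadrature at the zeros of the degree `k` orthogonal polynomial is exact for
polynomials of degree less than `2 * k`. -/
theorem integral_nodeInterp_orthNodes {p : ℝ[X]} (hp : p.degree < ((2 * k : ℕ) : WithBot ℕ)) :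
    ∫ x, (nodeInterp (orthNodes ν k) (fun x => p.eval x)).eval x ∂ν = ∫ x, p.eval x ∂ν := by
  have hm := monic_monicOrth ν k
  have hdec := modByMonic_add_div p (monicOrth ν k)
  have hr : (p %ₘ monicOrth ν k).degree < (k : WithBot ℕ) := by
    have := degree_modByMonic_lt p hm
    rwa [degree_monicOrth] at this
  have hq : (p /ₘ monicOrth ν k).degree < (k : WithBot ℕ) := by
    rcases eq_or_ne (p /ₘ monicOrth ν k) 0 with h0 | h0
    · rw [h0, degree_zero]; exact WithBot.bot_lt_coe _
    · have hp0 : p ≠ 0 := fun h => h0 (by rw [h, zero_divByMonic])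
      rw [degree_eq_natDegree h0, Nat.cast_lt, natDegree_divByMonic p hm, natDegree_monicOrth]
      rw [degree_eq_natDegree hp0, Nat.cast_lt] at hp
      omega
  -- At the zeros of π_k, p agrees with its remainder modulo π_k, so the remainder is the
  -- interpolant. The quotient has degree below k and is orthogonal to π_k.
  have hi : nodeInterp (orthNodes ν k) (fun x => p.eval x) = p %ₘ monicOrth ν k := by
    refine (Lagrange.eq_interpolate_of_eval_eq _ Function.injective_id.injOn
      (by rwa [card_orthNodes hint hk]) fun θ hθ => ?_).symm
    have hroot : (monicOrth ν k).eval θ = 0 :=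
      isRoot_of_mem_roots (Multiset.mem_toFinset.mp hθ)
    conv_rhs => rw [← hdec]
    simp [hroot]
  rw [hi, ← polyInt_apply hint, ← polyInt_apply hint]
  conv_rhs => rw [← hdec]
  rw [map_add, polyInt_monicOrth_mul hint hk le_rfl hq, add_zero]

/-- The square of a Lagrange basis polynomial has degree 2k - 2, so the rule is exact on it and
returns precisely the weight at θ. -/
theorem integral_basis_orthNodes_nonneg {θ : ℝ} (hθ : θ ∈ orthNodes ν k) :
    0 ≤ ∫ x, (Lagrange.basis (orthNodes ν k) id θ).eval x ∂ν := by
  set l := Lagrange.basis (orthNodes ν k) id θ with hl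
  have hcard := card_orthNodes hint hk
  have hk0 : 0 < k := by rw [← hcard]; exact Finset.card_pos.mpr ⟨θ, hθ⟩
  have hl0 : l ≠ 0 := Lagrange.basis_ne_zero Function.injective_id.injOn hθ
  have hdeg : (l * l).degree < ((2 * k : ℕ) : WithBot ℕ) := by
    rw [degree_eq_natDegree (mul_ne_zero hl0 hl0), natDegree_mul hl0 hl0,
      Lagrange.natDegree_basis Function.injective_id.injOn hθ, hcard, Nat.cast_lt]
    omega
  have h1 := integral_nodeInterp_orthNodes hint hk hdeg
  rw [integral_nodeInterp hint, Finset.sum_eq_single θ] at h1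
  · have h2 : l.eval θ = 1 := Lagrange.eval_basis_self (v := id) Function.injective_id.injOn hθ
    rw [eval_mul, h2, one_mul, one_mul] at h1
    rw [h1]
    exact polyInt_mul_self_nonneg hint l
  · intro η hη hne
    have h2 : l.eval η = 0 := Lagrange.eval_basis_of_ne (v := id) hne.symm hη
    simp [h2]
  · exact fun h => absurd hθ h

end Orthogonality

/-! ### Integration against signed measures -/

section SignedMeasures

theorem isFiniteMeasure_variation (Q : SignedMeasure ℝ) : IsFiniteMeasure Q.variation := by
  rw [← SignedMeasure.totalVariation_eq_variation, SignedMeasure.totalVariation]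
  infer_instance

theorem dTV_nonneg (Q : SignedMeasure ℝ) : 0 ≤ dTV Q := measureReal_nonneg

theorem abs_integral_le_dTV_mul {Q : SignedMeasure ℝ} {s : Set ℝ} (hQ : Q.variation sᶜ = 0)
    {g : ℝ → ℝ} {M : ℝ} (h : ∀ x ∈ s, |g x| ≤ M) : |∫ᵛ x, g x ∂•Q| ≤ dTV Q * M := by
  have := isFiniteMeasure_variation Q
  have hae : ∀ᵐ x ∂Q.variation, x ∈ s := hQ
  have h1 := VectorMeasure.norm_integral_le_integral_norm (μ := Q) (f := g)
    (B := ContinuousLinearMap.lsmul ℝ ℝ)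
  have h2 : ∫ x, ‖g x‖ ∂Q.variation ≤ dTV Q * M := by
    have := integral_mono_of_nonneg (μ := Q.variation) (f := fun x => ‖g x‖) (g := fun _ => M)
      (Filter.Eventually.of_forall fun _ => norm_nonneg _) (integrable_const M)
      (hae.mono fun x hx => h x hx)
    simpa [dTV] using this
  have h3 : ‖(ContinuousLinearMap.lsmul ℝ ℝ : ℝ →L[ℝ] ℝ →L[ℝ] ℝ)‖ ≤ 1 :=
    ContinuousLinearMap.opNorm_lsmul_le
  calc |∫ᵛ x, g x ∂•Q| ≤ _ := h1
    _ ≤ 1 * ∫ x, ‖g x‖ ∂Q.variation :=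
      mul_le_mul_of_nonneg_right h3 (integral_nonneg fun _ => norm_nonneg _)
    _ ≤ _ := by rwa [one_mul]

variable {nv : ℕ} {Q : Fin nv → SignedMeasure ℝ}

theorem integrable_avgSigned {g : ℝ → ℝ} (hg : ∀ l, (Q l).Integrable g) :
    (avgSigned Q).Integrable g :=
  VectorMeasure.Integrable.smul_vectorMeasure
    (VectorMeasure.Integrable.finsetSum_vectorMeasure fun l _ => hg l) _

theorem integral_avgSigned {g : ℝ → ℝ} (hg : ∀ l, (Q l).Integrable g) :
    ∫ᵛ x, g x ∂•(avgSigned Q) = (nv : ℝ)⁻¹ * ∑ l, ∫ᵛ x, g x ∂•(Q l) := by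
  rw [avgSigned, VectorMeasure.integral_smul_vectorMeasure,
    VectorMeasure.integral_finsetSum_vectorMeasure fun l _ => hg l, smul_eq_mul]

/-- The variation of a set is zero once every measurable subset has signed measure zero. -/
theorem variation_avgSigned_compl {s : Set ℝ} (hs : MeasurableSet s)
    (hQ : ∀ l t, MeasurableSet t → t ⊆ sᶜ → Q l t = 0) : (avgSigned Q).variation sᶜ = 0 := by
  rw [VectorMeasure.variation_apply_eq_zero hs.compl]
  intro t ht htm
  rw [avgSigned, smul_apply]
  have : (∑ l, Q l) t = ∑ l, Q l t := by
    simp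
  rw [this, Finset.sum_eq_zero fun l _ => hQ l t htm ht, smul_zero]

theorem integrable_nodeMeasure (t : Finset ℝ) (ν : Measure ℝ) (g : ℝ → ℝ) :
    (nodeMeasure t ν).Integrable g := by
  refine VectorMeasure.Integrable.finsetSum_vectorMeasure fun θ _ =>
    VectorMeasure.Integrable.smul_vectorMeasure ?_ _
  rw [VectorMeasure.Integrable, Measure.variation_toSignedMeasure]
  exact integrable_dirac (by simp)

theorem integral_nodeMeasure (t : Finset ℝ) (ν : Measure ℝ) (g : ℝ → ℝ) :
    ∫ᵛ x, g x ∂•(nodeMeasure t ν) =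
      ∑ θ ∈ t, g θ * ∫ x, (Lagrange.basis t id θ).eval x ∂ν := by
  have hd : ∀ θ : ℝ, ((Measure.dirac θ).toSignedMeasure).Integrable g := fun θ => by
    rw [VectorMeasure.Integrable, Measure.variation_toSignedMeasure]
    exact integrable_dirac (by simp)
  rw [nodeMeasure, VectorMeasure.integral_finsetSum_vectorMeasure fun θ _ =>
    VectorMeasure.Integrable.smul_vectorMeasure (hd θ) _]
  refine Finset.sum_congr rfl fun θ _ => ?_
  have h1 : ∫ᵛ x, g x ∂•((Measure.dirac θ).toSignedMeasure) = g θ := by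
    have h2 : (Measure.dirac θ).toSignedMeasure = VectorMeasure.dirac θ (1 : ℝ) := by
      ext s hs
      by_cases hx : θ ∈ s <;> simp [Measure.toSignedMeasure_apply, hs, hx, measureReal_def]
    rw [h2, VectorMeasure.integral_dirac]
    simp
  rw [VectorMeasure.integral_smul_vectorMeasure, h1, smul_eq_mul, mul_comm]

theorem nodeMeasure_apply_eq_zero {t : Finset ℝ} {s u : Set ℝ} (hts : ∀ θ ∈ t, θ ∈ s)
    (ν : Measure ℝ) (hu : MeasurableSet u) (hus : u ⊆ sᶜ) : nodeMeasure t ν u = 0 := by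
  have : nodeMeasure t ν u = ∑ θ ∈ t, (∫ x, (Lagrange.basis t id θ).eval x ∂ν) *
      (Measure.dirac θ).toSignedMeasure u := by
    simp [nodeMeasure]
  rw [this]
  refine Finset.sum_eq_zero fun θ hθ => ?_
  have h1 : θ ∉ u := fun h => hus h (hts θ hθ)
  simp [Measure.toSignedMeasure_apply, hu, measureReal_def, h1]

end SignedMeasures

theorem integral_real_toSignedMeasure (m : Measure ℝ) [IsFiniteMeasure m] (f : ℝ → ℝ) :
    ∫ᵛ x, f x ∂•m.toSignedMeasure = ∫ x, f x ∂m := by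
  have h : (ContinuousLinearMap.lsmul ℝ ℝ : ℝ →L[ℝ] ℝ →L[ℝ] ℝ).flip =
      ContinuousLinearMap.lsmul ℝ ℝ := by
    ext; simp
  rw [← VectorMeasure.integral_toSignedMeasure, h]

/-! ### Signed measures given by a density -/

section Density

variable {μ : Measure ℝ} {f g : ℝ → ℝ}

theorem integrable_withDensity_ofReal (hg : Measurable g) (hf : AEStronglyMeasurable f μ)
    (hfg : Integrable (fun x => f x * g x) μ) :
    Integrable f (μ.withDensity fun x => ENNReal.ofReal (g x)) := by
  rw [integrable_withDensity_iff_integrable_smul' hg.ennreal_ofReal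
    (Filter.Eventually.of_forall fun _ => ENNReal.ofReal_lt_top)]
  refine hfg.mono (hg.ennreal_ofReal.ennreal_toReal.aestronglyMeasurable.smul hf)
    (Filter.Eventually.of_forall fun x => ?_)
  rw [smul_eq_mul, norm_mul, norm_mul, mul_comm]
  refine mul_le_mul_of_nonneg_left ?_ (norm_nonneg _)
  rw [Real.norm_of_nonneg ENNReal.toReal_nonneg, ENNReal.toReal_ofReal', Real.norm_eq_abs]
  exact max_le (le_abs_self _) (abs_nonneg _)

theorem integral_withDensity_ofReal (hg : Measurable g) :
    ∫ x, f x ∂(μ.withDensity fun x => ENNReal.ofReal (g x)) = ∫ x, max (g x) 0 * f x ∂μ := by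
  rw [integral_withDensity_eq_integral_toReal_smul hg.ennreal_ofReal
    (Filter.Eventually.of_forall fun _ => ENNReal.ofReal_lt_top)]
  simp only [ENNReal.toReal_ofReal', smul_eq_mul]

theorem integrable_withDensityᵥ (hg : Measurable g) (hgi : Integrable g μ)
    (hf : AEStronglyMeasurable f μ) (hfg : Integrable (fun x => f x * g x) μ) :
    (μ.withDensityᵥ g).Integrable f := by
  have h1 := isFiniteMeasure_withDensity_ofReal hgi.2
  have h2 := isFiniteMeasure_withDensity_ofReal hgi.neg.2
  rw [withDensityᵥ_eq_withDensity_pos_part_sub_withDensity_neg_part hgi]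
  refine VectorMeasure.Integrable.sub_vectorMeasure ?_ ?_
  · rw [VectorMeasure.Integrable, Measure.variation_toSignedMeasure]
    exact integrable_withDensity_ofReal hg hf hfg
  · rw [VectorMeasure.Integrable, Measure.variation_toSignedMeasure]
    exact integrable_withDensity_ofReal hg.neg hf (by simpa using hfg.neg)

theorem integral_withDensityᵥ (hg : Measurable g) (hgi : Integrable g μ)
    (hf : AEStronglyMeasurable f μ) (hfg : Integrable (fun x => f x * g x) μ) :
    ∫ᵛ x, f x ∂•(μ.withDensityᵥ g) = ∫ x, f x * g x ∂μ := by
  have h1 := isFiniteMeasure_withDensity_ofReal hgi.2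
  have h2 := isFiniteMeasure_withDensity_ofReal hgi.neg.2
  have hi1 := integrable_withDensity_ofReal hg hf hfg
  have hi2 := integrable_withDensity_ofReal (μ := μ) (f := f) hg.neg hf (by simpa using hfg.neg)
  have hpos : Integrable (fun x => max (g x) 0 * f x) μ := by
    rw [integrable_withDensity_iff_integrable_smul' hg.ennreal_ofReal
      (Filter.Eventually.of_forall fun _ => ENNReal.ofReal_lt_top)] at hi1
    simpa only [ENNReal.toReal_ofReal', smul_eq_mul] using hi1
  have hneg : Integrable (fun x => max ((-g) x) 0 * f x) μ := by
    rw [integrable_withDensity_iff_integrable_smul' hg.neg.ennreal_ofReal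
      (Filter.Eventually.of_forall fun _ => ENNReal.ofReal_lt_top)] at hi2
    simpa only [ENNReal.toReal_ofReal', smul_eq_mul] using hi2
  -- The vector integral is computed on the positive and negative parts of the density, and max(g,0)
  -- - max(-g,0) = g reassembles them.
  rw [withDensityᵥ_eq_withDensity_pos_part_sub_withDensity_neg_part hgi,
    VectorMeasure.integral_sub_vectorMeasure]
  · rw [integral_real_toSignedMeasure, integral_real_toSignedMeasure,
      integral_withDensity_ofReal hg]
    have := integral_withDensity_ofReal (μ := μ) (f := f) hg.neg
    simp only [Pi.neg_apply] at this hneg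
    rw [this, ← integral_sub hpos hneg]
    refine integral_congr_ae (Filter.Eventually.of_forall fun x => ?_)
    simp only
    rcases le_total 0 (g x) with h | h
    · rw [max_eq_left h, max_eq_right (neg_nonpos.mpr h)]; ring
    · rw [max_eq_right h, max_eq_left (neg_nonneg.mpr h)]; ring
  · rw [VectorMeasure.Integrable, Measure.variation_toSignedMeasure]
    exact hi1
  · rw [VectorMeasure.Integrable, Measure.variation_toSignedMeasure]
    exact hi2

end Density

/-! ### Uniform norms -/

section UniformNorm

variable {a b : ℝ} {f : ℝ → ℝ} {lo hi : ℝ}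

theorem abs_sub_eval_le_uniformNorm (hf : ∀ x ∈ Set.Icc a b, f x ∈ Set.Icc lo hi) (p : ℝ[X])
    {x : ℝ} (hx : x ∈ Set.Icc a b) :
    |f x - p.eval x| ≤ uniformNorm a b (fun x => f x - p.eval x) := by
  obtain ⟨C, hC⟩ := (isCompact_Icc (a := a) (b := b)).exists_bound_of_continuousOn
    p.continuous.continuousOn
  -- The supremum of an unbounded family of reals is 0 by convention, so a bound must be shown; it
  -- comes from the bounds on f and from continuity of p.
  refine le_ciSup (f := fun y : Set.Icc a b => |f y - p.eval (y : ℝ)|) ?_ ⟨x, hx⟩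
  refine ⟨max |lo| |hi| + C, ?_⟩
  rintro _ ⟨y, rfl⟩
  have h1 := hC y y.2
  have h2 := hf y y.2
  have h3 : |f y| ≤ max |lo| |hi| := abs_le_max_abs_abs h2.1 h2.2
  exact (abs_sub _ _).trans (add_le_add h3 h1)

theorem uniformNorm_nonneg (g : ℝ → ℝ) : 0 ≤ uniformNorm a b g :=
  Real.iSup_nonneg fun _ => abs_nonneg _

/-- To bound a quantity by a multiple of the best approximation error it suffices to compare with
every polynomial. -/
theorem le_mul_bestError {s : ℕ} {e c : ℝ} (hc : 0 ≤ c)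
    (h : ∀ p : ℝ[X], p.natDegree ≤ s → e ≤ c * uniformNorm a b (fun x => f x - p.eval x)) :
    e ≤ c * bestError s a b f := by
  rw [bestError, Real.mul_iInf_of_nonneg hc]
  have : Nonempty {p : ℝ[X] // p.natDegree ≤ s} := ⟨⟨0, by simp⟩⟩
  exact le_ciInf fun p => h p.1 p.2

end UniformNorm

theorem degree_lt_of_natDegree_le {p : ℝ[X]} {s : ℕ} (hp : p.natDegree ≤ s) :
    p.degree < ((s + 1 : ℕ) : WithBot ℕ) :=
  degree_le_natDegree.trans_lt (by exact_mod_cast Nat.lt_succ_of_le hp)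

/-! ### Quadrature errors -/

section QuadError

variable {s nv : ℕ} {T : PolyApprox s} {Ψ : Fin nv → Measure ℝ} {f : ℝ → ℝ}

theorem inv_mul_sum_const (hnv : 0 < nv) (c : ℝ) : (nv : ℝ)⁻¹ * ∑ _l : Fin nv, c = c := by
  have : (nv : ℝ) ≠ 0 := by exact_mod_cast hnv.ne'
  simp [this]

theorem quadError_le_avg (hΨ : ∀ l, Integrable f (Ψ l)) {e : Fin nv → ℝ}
    (h : ∀ l, |∫ x, f x ∂(Ψ l) - ∫ x, (T.toPoly (Ψ l) f).eval x ∂(Ψ l)| ≤ e l) :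
    quadError T Ψ f ≤ (nv : ℝ)⁻¹ * ∑ l, e l := by
  rw [quadError, quadIntegral, integral_avgMeasure hΨ, ← mul_sub, ← Finset.sum_sub_distrib,
    abs_mul, abs_of_nonneg (by positivity : (0 : ℝ) ≤ (nv : ℝ)⁻¹)]
  exact mul_le_mul_of_nonneg_left ((Finset.abs_sum_le_sum_abs _ _).trans
    (Finset.sum_le_sum fun l _ => h l)) (by positivity)

/-- The error of a quadrature rule given by signed measures and reproducing a polynomial `p`. -/
theorem quadError_le_of_reproducing (hnv : 0 < nv) [∀ l, IsProbabilityMeasure (Ψ l)] {a b M : ℝ}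
    (hsupp : ∀ l, Ψ l (Set.Icc a b)ᶜ = 0) (hΨ : ∀ l (g : ℝ → ℝ), Integrable g (Ψ l))
    {Q : SignedMeasure ℝ} (hQ : Q.variation (Set.Icc a b)ᶜ = 0) {p : ℝ[X]}
    (hfi : Q.Integrable f) (hpi : Q.Integrable fun x => p.eval x)
    (hfQ : quadIntegral T Ψ f = ∫ᵛ x, f x ∂•Q)
    (hpQ : quadIntegral T Ψ (fun x => p.eval x) = ∫ᵛ x, p.eval x ∂•Q)
    (hp : ∀ l, T.toPoly (Ψ l) (fun x => p.eval x) = p)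
    (hfp : ∀ x ∈ Set.Icc a b, |f x - p.eval x| ≤ M) :
    quadError T Ψ f ≤ (1 + dTV Q) * M := by
  have h1 : ∫ᵛ x, p.eval x ∂•Q = ∫ x, p.eval x ∂(avgMeasure Ψ) := by
    rw [← hpQ, quadIntegral, integral_avgMeasure fun l => hΨ l _]
    simp only [hp]
  have h2 : ∫ x, f x ∂(avgMeasure Ψ) - quadIntegral T Ψ f =
      ∫ x, (f x - p.eval x) ∂(avgMeasure Ψ) - ∫ᵛ x, (f x - p.eval x) ∂•Q := by
    rw [hfQ, VectorMeasure.integral_fun_sub hfi hpi, integral_sub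
      (integrable_avgMeasure hnv fun l => hΨ l _) (integrable_avgMeasure hnv fun l => hΨ l _), h1]
    ring
  have h3 : |∫ x, (f x - p.eval x) ∂(avgMeasure Ψ)| ≤ M := by
    rw [integral_avgMeasure fun l => hΨ l _, abs_mul,
      abs_of_nonneg (by positivity : (0 : ℝ) ≤ (nv : ℝ)⁻¹)]
    calc _ ≤ (nv : ℝ)⁻¹ * ∑ _l : Fin nv, M :=
          mul_le_mul_of_nonneg_left ((Finset.abs_sum_le_sum_abs _ _).trans
            (Finset.sum_le_sum fun l _ =>
              abs_integral_le_of_supported (hsupp l) (hΨ l _) hfp)) (by positivity)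
      _ = M := inv_mul_sum_const hnv M
  have h4 := abs_integral_le_dTV_mul hQ hfp
  rw [quadError, h2]
  calc _ ≤ M + dTV Q * M := (abs_sub _ _).trans (add_le_add h3 h4)
    _ = _ := by ring

end QuadError

/-! ### Gaussian quadrature -/

theorem integrable_eval_of_supported {ν : Measure ℝ} [IsFiniteMeasure ν] {a b : ℝ}
    (hsupp : ν (Set.Icc a b)ᶜ = 0) (p : ℝ[X]) : Integrable (fun x => p.eval x) ν := by
  obtain ⟨C, hC⟩ := (isCompact_Icc (a := a) (b := b)).exists_bound_of_continuousOn
    p.continuous.continuousOn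
  have hae : ∀ᵐ x ∂ν, x ∈ Set.Icc a b := hsupp
  exact Integrable.of_bound p.continuous.aestronglyMeasurable C (hae.mono fun x hx => hC x hx)

/-- Either all polynomials of degree below k have nonzero norm and m = k, or m is the first degree
at which the norm vanishes. -/
theorem exists_gaussNodes_eq (ν : Measure ℝ) (k : ℕ) : ∃ m ≤ k, gaussNodes ν k = orthNodes ν m ∧
    HasOrth ν m ∧ (m < k → ∫ x, (monicOrth ν m).eval x ^ 2 ∂ν = 0) := by
  classical
  refine ⟨Nat.findGreatest (fun j => HasOrth ν j) k, Nat.findGreatest_le k, ?_, ?_, ?_⟩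
  · simp only [gaussNodes, HasOrth]
    congr
  · exact Nat.findGreatest_spec (P := fun j => HasOrth ν j) (Nat.zero_le k)
      fun i hi => absurd hi (Nat.not_lt_zero i)
  · intro hlt
    set m := Nat.findGreatest (fun j => HasOrth ν j) k with hm
    have hspec : HasOrth ν m := Nat.findGreatest_spec (P := fun j => HasOrth ν j) (Nat.zero_le k)
      fun i hi => absurd hi (Nat.not_lt_zero i)
    by_contra h0
    refine Nat.findGreatest_is_greatest (P := fun j => HasOrth ν j) (n := k) (k := m + 1)
      (by omega) (by omega) fun i hi => ?_
    rcases Nat.lt_succ_iff_lt_or_eq.mp hi with h | rfl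
    · exact hspec i h
    · exact h0

/-- If the recurrence stops at m < k, then π_m vanishes almost everywhere, almost every point is a
node and the error is 0. Otherwise p is integrated exactly and f - p contributes M from ν and M from
the rule. -/
theorem abs_integral_sub_gauss_le {ν : Measure ℝ} [IsProbabilityMeasure ν] {a b M : ℝ}
    (hsupp : ν (Set.Icc a b)ᶜ = 0) (hint : ∀ g : ℝ → ℝ, Integrable g ν) {k : ℕ} (hk : 0 < k)
    (hM : 0 ≤ M) {f : ℝ → ℝ} {p : ℝ[X]} (hp : p.natDegree ≤ 2 * k - 1)
    (hfp : ∀ x ∈ Set.Icc a b, |f x - p.eval x| ≤ M) :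
    |∫ x, f x ∂ν - ∫ x, ((gauss k).toPoly ν f).eval x ∂ν| ≤ 2 * M := by
  have hpint : ∀ p : ℝ[X], Integrable (fun x => p.eval x) ν := fun p => hint _
  obtain ⟨m, hmk, hnodes, horth, hlast⟩ := exists_gaussNodes_eq ν k
  have hT : (gauss k).toPoly ν f = nodeInterp (orthNodes ν m) f := by
    rw [← hnodes]; rfl
  rw [hT]
  rcases hmk.lt_or_eq with hlt | rfl
  · have h0 : polyInt hpint (monicOrth ν m * monicOrth ν m) = 0 := by
      simpa only [polyInt_apply, eval_mul, ← pow_two, eval_pow] using hlast hlt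
    have hae := ae_eq_zero_of_polyInt_mul_self hpint h0
    have heq : ∫ x, (nodeInterp (orthNodes ν m) f).eval x ∂ν = ∫ x, f x ∂ν := by
      refine integral_congr_ae ?_
      filter_upwards [hae] with x hx
      have hmem : x ∈ orthNodes ν m :=
        Multiset.mem_toFinset.mpr ((mem_roots (monic_monicOrth ν m).ne_zero).mpr hx)
      exact Lagrange.eval_interpolate_at_node (v := id) f Function.injective_id.injOn hmem
    rw [heq, sub_self, abs_zero]
    positivity
  · have hdeg : p.degree < ((2 * m : ℕ) : WithBot ℕ) := by
      have := degree_lt_of_natDegree_le hp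
      rwa [show 2 * m - 1 + 1 = 2 * m by omega] at this
    set w : ℝ → ℝ := fun θ => ∫ x, (Lagrange.basis (orthNodes ν m) id θ).eval x ∂ν with hw
    have h1 : ∀ g : ℝ → ℝ, ∫ x, (nodeInterp (orthNodes ν m) g).eval x ∂ν =
        ∑ θ ∈ orthNodes ν m, g θ * w θ := integral_nodeInterp hpint _
    have h2 := integral_nodeInterp_orthNodes hpint horth hdeg
    have hone : ((1 : ℝ[X])).degree < ((2 * m : ℕ) : WithBot ℕ) := by
      rw [degree_one]; exact_mod_cast (by omega : 0 < 2 * m)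
    -- Exactness on the constant 1 shows that the weights sum to 1.
    have h3 := integral_nodeInterp_orthNodes hpint horth hone
    rw [h1] at h2 h3
    simp only [eval_one, one_mul, integral_const, smul_eq_mul, mul_one, probReal_univ] at h3
    have h4 : |∑ θ ∈ orthNodes ν m, (f θ - p.eval θ) * w θ| ≤ M := by
      calc _ ≤ ∑ θ ∈ orthNodes ν m, |(f θ - p.eval θ) * w θ| := Finset.abs_sum_le_sum_abs _ _
        _ ≤ ∑ θ ∈ orthNodes ν m, M * w θ := by
          refine Finset.sum_le_sum fun θ hθ => ?_
          have hw0 := integral_basis_orthNodes_nonneg hpint horth hθ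
          rw [abs_mul, abs_of_nonneg hw0]
          exact mul_le_mul_of_nonneg_right
            (hfp θ (orthNodes_subset_Icc hpint horth hsupp hθ)) hw0
        _ = M := by rw [← Finset.mul_sum, h3, mul_one]
    have h5 := abs_integral_le_of_supported hsupp (hint _) hfp
    have h6 : ∫ x, f x ∂ν - ∫ x, (nodeInterp (orthNodes ν m) f).eval x ∂ν =
        ∫ x, (f x - p.eval x) ∂ν - ∑ θ ∈ orthNodes ν m, (f θ - p.eval θ) * w θ := by
      rw [integral_sub (hint _) (hint _), h1, ← h2]
      simp only [sub_mul, Finset.sum_sub_distrib]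
      ring
    rw [h6, two_mul]
    exact (abs_sub _ _).trans (add_le_add h5 h4)

/-! ### Reference measures -/

section Reference

variable {μ : Measure ℝ} {a b : ℝ} {s : ℕ}

theorem IsReference.integrable_eval (h : IsReference μ a b s) (p : ℝ[X]) :
    Integrable (fun x => p.eval x) μ :=
  have := h.isProb
  integrable_eval_of_supported h.supported p

/-- If π_i had norm zero for some i ≤ s, μ would be concentrated on its at most s zeros. -/
theorem IsReference.hasOrth (h : IsReference μ a b s) : HasOrth μ (s + 1) := by
  intro i hi h0
  have h1 : polyInt h.integrable_eval (monicOrth μ i * monicOrth μ i) = 0 := by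
    simpa only [polyInt_apply, eval_mul, ← pow_two, eval_pow] using h0
  refine h.nondegenerate (orthNodes μ i) ((card_orthNodes_le μ i).trans (by omega)) ?_
  have hae := ae_eq_zero_of_polyInt_mul_self h.integrable_eval h1
  refine measure_mono_null (fun x hx => ?_) hae
  intro hx0
  exact hx (Finset.mem_coe.mpr (Multiset.mem_toFinset.mpr
    ((mem_roots (monic_monicOrth μ i).ne_zero).mpr hx0)))

theorem IsReference.interp_toPoly_eval (h : IsReference μ a b s) (ν : Measure ℝ) {p : ℝ[X]}
    (hp : p.natDegree ≤ s) : (interp μ s).toPoly ν (fun x => p.eval x) = p := by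
  refine nodeInterp_eq_self ?_
  rw [card_orthNodes h.integrable_eval h.hasOrth]
  exact degree_lt_of_natDegree_le hp

/-- The projection on the orthonormal polynomials in terms of the monic ones. -/
theorem approx_toPoly (μ ν : Measure ℝ) (s : ℕ) (f : ℝ → ℝ) :
    (approx μ s).toPoly ν f = ∑ i ∈ Finset.range (s + 1),
      C ((∫ x, f x * (monicOrth μ i).eval x ∂μ) / ∫ x, (monicOrth μ i).eval x ^ 2 ∂μ) *
        monicOrth μ i := by
  simp only [approx]
  refine Finset.sum_congr rfl fun i _ => ?_
  set N := ∫ x, (monicOrth μ i).eval x ^ 2 ∂μ with hN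
  have hN0 : 0 ≤ N := integral_nonneg fun x => sq_nonneg _
  have h1 : ∀ x, f x * (orthonormalPoly μ i).eval x =
      (√N)⁻¹ * (f x * (monicOrth μ i).eval x) := fun x => by
    simp only [orthonormalPoly, eval_mul, eval_C, ← hN]; ring
  simp_rw [h1]
  rw [integral_const_mul, orthonormalPoly, ← hN, ← mul_assoc, ← C_mul]
  congr 2
  rw [mul_right_comm, ← mul_inv, Real.mul_self_sqrt hN0, div_eq_inv_mul]

/-- The residual r has degree d ≤ s and is orthogonal to π_0, …, π_s. Pairing it with π_d gives its
leading coefficient times ‖π_d‖², so r = 0. -/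
theorem IsReference.approx_toPoly_eval (h : IsReference μ a b s) (ν : Measure ℝ) {p : ℝ[X]}
    (hp : p.natDegree ≤ s) : (approx μ s).toPoly ν (fun x => p.eval x) = p := by
  set r := p - (approx μ s).toPoly ν (fun x => p.eval x) with hr
  suffices r = 0 from (sub_eq_zero.mp this).symm
  have hrd : r.natDegree ≤ s := (natDegree_sub_le _ _).trans
    (max_le hp ((approx μ s).natDegree_le ν _))
  have hN : ∀ i, (∫ x, (monicOrth μ i).eval x ^ 2 ∂μ) =
      polyInt h.integrable_eval (monicOrth μ i * monicOrth μ i) := fun i => by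
    simp only [polyInt_apply, eval_mul, sq]
  have hP : ∀ i, (∫ x, p.eval x * (monicOrth μ i).eval x ∂μ) =
      polyInt h.integrable_eval (p * monicOrth μ i) := fun i => by
    simp only [polyInt_apply, eval_mul]
  have horth : ∀ d ≤ s, polyInt h.integrable_eval (r * monicOrth μ d) = 0 := by
    intro d hd
    rw [hr, approx_toPoly, sub_mul, map_sub, Finset.sum_mul, map_sum]
    simp only [mul_assoc, polyInt_C_mul]
    rw [Finset.sum_eq_single d]
    · rw [hP, hN, div_mul_cancel₀, sub_self]
      rw [← hN]
      exact h.hasOrth d (by omega)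
    · intro i hi hid
      have his : i ≤ s := by simpa [Nat.lt_succ_iff] using hi
      rcases lt_or_gt_of_ne hid with hlt | hlt
      · rw [mul_comm (monicOrth μ i), polyInt_monicOrth_mul_monicOrth h.integrable_eval h.hasOrth
          (by omega) i hlt, mul_zero]
      · rw [polyInt_monicOrth_mul_monicOrth h.integrable_eval h.hasOrth
          (by omega) d hlt, mul_zero]
    · intro hd'
      simp only [Finset.mem_range, not_lt] at hd'
      omega
  by_contra hr0
  set d := r.natDegree with hd
  set q := r - C (r.coeff d) * monicOrth μ d with hq
  have hqd : q.degree < (d : WithBot ℕ) :=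
    degree_sub_C_mul_monicOrth_lt μ (degree_lt_of_natDegree_le hd.ge)
  have h1 := horth d hrd
  have h2 : r = C (r.coeff d) * monicOrth μ d + q := by rw [hq]; ring
  have h3 := polyInt_monicOrth_mul h.integrable_eval h.hasOrth (by omega) hqd
  rw [h2, add_mul, map_add, mul_comm q, h3, add_zero, mul_assoc, polyInt_C_mul, ← hN] at h1
  rcases mul_eq_zero.mp h1 with h4 | h4
  · exact leadingCoeff_ne_zero.mpr hr0 h4
  · exact h.hasOrth d (by omega) h4

end Reference

/-! ### The signed measures of the quadrature rules -/

theorem quadIntegral_of_nodeInterp {s nv : ℕ} {T : PolyApprox s} {Ψ : Fin nv → Measure ℝ}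
    {t : Fin nv → Finset ℝ} {f : ℝ → ℝ} (hΨ : ∀ l (g : ℝ → ℝ), Integrable g (Ψ l))
    (hT : ∀ l, T.toPoly (Ψ l) f = nodeInterp (t l) f) :
    quadIntegral T Ψ f = ∫ᵛ x, f x ∂•(avgSigned fun l => nodeMeasure (t l) (Ψ l)) := by
  rw [integral_avgSigned fun l => integrable_nodeMeasure _ _ f, quadIntegral]
  congr 1
  refine Finset.sum_congr rfl fun l _ => ?_
  rw [hT, integral_nodeMeasure, integral_nodeInterp fun p => hΨ l _]

section ApproxMeasure

variable {μ : Measure ℝ} {a b : ℝ} {s : ℕ}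

/-- The density of the signed measure of quadrature by approximation, as a polynomial. -/
def approxDensity (μ : Measure ℝ) (s : ℕ) (ν : Measure ℝ) : ℝ[X] :=
  ∑ i ∈ Finset.range (s + 1),
    C (∫ y, (orthonormalPoly μ i).eval y ∂ν) * orthonormalPoly μ i

theorem approxMeasure_eq (μ : Measure ℝ) (s : ℕ) (ν : Measure ℝ) :
    approxMeasure μ s ν = μ.withDensityᵥ fun x => (approxDensity μ s ν).eval x := by
  simp only [approxMeasure, approxDensity, eval_finsetSum, eval_mul, eval_C]

theorem IsReference.integrable_mul_eval (h : IsReference μ a b s) {f : ℝ → ℝ} {lo hi : ℝ}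
    (hfm : AEMeasurable f μ) (hf : ∀ x ∈ Set.Icc a b, f x ∈ Set.Icc lo hi) (p : ℝ[X]) :
    Integrable (fun x => f x * p.eval x) μ := by
  have hae : ∀ᵐ x ∂μ, x ∈ Set.Icc a b := h.supported
  exact (h.integrable_eval p).bdd_mul (c := max |lo| |hi|) hfm.aestronglyMeasurable
    (hae.mono fun x hx => abs_le_max_abs_abs (hf x hx).1 (hf x hx).2)

theorem IsReference.integrable_approxMeasure (h : IsReference μ a b s) {f : ℝ → ℝ} {lo hi : ℝ}
    (hfm : AEMeasurable f μ) (hf : ∀ x ∈ Set.Icc a b, f x ∈ Set.Icc lo hi) (ν : Measure ℝ) :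
    (approxMeasure μ s ν).Integrable f := by
  rw [approxMeasure_eq]
  exact integrable_withDensityᵥ (Polynomial.continuous _).measurable (h.integrable_eval _)
    hfm.aestronglyMeasurable (h.integrable_mul_eval hfm hf _)

/-- Both sides equal ∑ m_i ∫ f p_i dμ with m_i = ∫ p_i dν: the finite sum is symmetric in the
moments of ν and the coefficients of f. -/
theorem IsReference.integral_approxMeasure (h : IsReference μ a b s) {f : ℝ → ℝ} {lo hi : ℝ}
    (hfm : AEMeasurable f μ) (hf : ∀ x ∈ Set.Icc a b, f x ∈ Set.Icc lo hi) {ν : Measure ℝ}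
    (hν : ∀ p : ℝ[X], Integrable (fun x => p.eval x) ν) :
    ∫ᵛ x, f x ∂•(approxMeasure μ s ν) = ∫ x, ((approx μ s).toPoly ν f).eval x ∂ν := by
  rw [approxMeasure_eq, integral_withDensityᵥ (Polynomial.continuous _).measurable
    (h.integrable_eval _) hfm.aestronglyMeasurable (h.integrable_mul_eval hfm hf _)]
  rw [← polyInt_apply hν]
  simp only [approx, map_sum, polyInt_C_mul, approxDensity, eval_finsetSum, Finset.mul_sum]
  rw [integral_finsetSum _ fun i _ => h.integrable_mul_eval hfm hf _]
  refine Finset.sum_congr rfl fun i _ => ?_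
  rw [polyInt_apply, ← integral_mul_const]
  refine integral_congr_ae (Filter.Eventually.of_forall fun x => ?_)
  simp only [eval_mul, eval_C]
  ring

theorem IsReference.approxMeasure_apply_eq_zero (h : IsReference μ a b s) (ν : Measure ℝ)
    {u : Set ℝ} (hu : MeasurableSet u) (hus : u ⊆ (Set.Icc a b)ᶜ) : approxMeasure μ s ν u = 0 := by
  rw [approxMeasure_eq, withDensityᵥ_apply (h.integrable_eval _) hu,
    setIntegral_measure_zero _ (measure_mono_null hus h.supported)]

end ApproxMeasure

/-! ### Error bounds for the individual rules -/

section Rules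

variable {nv : ℕ} {Ψ : Fin nv → Measure ℝ} {a b lo hi : ℝ} {f : ℝ → ℝ}

theorem quadError_le_uniformNorm {s : ℕ} (T : PolyApprox s) [∀ l, IsProbabilityMeasure (Ψ l)]
    (hsupp : ∀ l, Ψ l (Set.Icc a b)ᶜ = 0) (hΨ : ∀ l (g : ℝ → ℝ), Integrable g (Ψ l))
    (hf : ∀ x ∈ Set.Icc a b, f x ∈ Set.Icc lo hi) :
    quadError T Ψ f ≤
      (nv : ℝ)⁻¹ * ∑ l, uniformNorm a b (fun x => f x - (T.toPoly (Ψ l) f).eval x) := by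
  refine quadError_le_avg (fun l => hΨ l f) fun l => ?_
  rw [← integral_sub (hΨ l _) (hΨ l _)]
  exact abs_integral_le_of_supported (hsupp l) (hΨ l _)
    fun x hx => abs_sub_eval_le_uniformNorm hf _ hx

theorem quadError_gauss_le (hnv : 0 < nv) [∀ l, IsProbabilityMeasure (Ψ l)]
    (hsupp : ∀ l, Ψ l (Set.Icc a b)ᶜ = 0) (hΨ : ∀ l (g : ℝ → ℝ), Integrable g (Ψ l))
    (hf : ∀ x ∈ Set.Icc a b, f x ∈ Set.Icc lo hi) {k : ℕ} (hk : 0 < k) :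
    quadError (gauss k) Ψ f ≤ 2 * bestError (2 * k - 1) a b f := by
  refine le_mul_bestError (by norm_num) fun p hp => ?_
  rw [← inv_mul_sum_const hnv (2 * uniformNorm a b fun x => f x - p.eval x)]
  exact quadError_le_avg (fun l => hΨ l f) fun l => abs_integral_sub_gauss_le (hsupp l) (hΨ l) hk
    (uniformNorm_nonneg _) hp fun x hx => abs_sub_eval_le_uniformNorm hf _ hx

theorem quadError_interp_le (hnv : 0 < nv) [∀ l, IsProbabilityMeasure (Ψ l)]
    (hsupp : ∀ l, Ψ l (Set.Icc a b)ᶜ = 0) (hΨ : ∀ l (g : ℝ → ℝ), Integrable g (Ψ l))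
    (hf : ∀ x ∈ Set.Icc a b, f x ∈ Set.Icc lo hi) {s : ℕ} {μ : Measure ℝ}
    (hμ : IsReference μ a b s) :
    quadError (interp μ s) Ψ f ≤
      (1 + dTV (avgSigned fun l => interpMeasure μ s (Ψ l))) * bestError s a b f := by
  have hd := dTV_nonneg (avgSigned fun l => interpMeasure μ s (Ψ l))
  refine le_mul_bestError (by linarith) fun p hp => ?_
  refine quadError_le_of_reproducing hnv (p := p) hsupp hΨ
    (variation_avgSigned_compl measurableSet_Icc fun l t ht hts => nodeMeasure_apply_eq_zero
      (fun θ hθ => orthNodes_subset_Icc hμ.integrable_eval hμ.hasOrth hμ.supported hθ) _ ht hts)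
    (integrable_avgSigned fun l => integrable_nodeMeasure _ _ _)
    (integrable_avgSigned fun l => integrable_nodeMeasure _ _ _)
    (quadIntegral_of_nodeInterp hΨ fun _ => rfl) (quadIntegral_of_nodeInterp hΨ fun _ => rfl)
    (fun l => hμ.interp_toPoly_eval _ hp) fun x hx => abs_sub_eval_le_uniformNorm hf _ hx

theorem quadIntegral_approx (hΨ : ∀ l (g : ℝ → ℝ), Integrable g (Ψ l))
    (hf : ∀ x ∈ Set.Icc a b, f x ∈ Set.Icc lo hi) {s : ℕ} {μ : Measure ℝ}
    (hμ : IsReference μ a b s) (hfm : AEMeasurable f μ) :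
    quadIntegral (approx μ s) Ψ f =
      ∫ᵛ x, f x ∂•(avgSigned fun l => approxMeasure μ s (Ψ l)) := by
  rw [integral_avgSigned fun l => hμ.integrable_approxMeasure hfm hf _, quadIntegral]
  congr 1
  exact Finset.sum_congr rfl fun l _ =>
    (hμ.integral_approxMeasure hfm hf fun p => hΨ l _).symm

theorem exists_eval_mem_Icc (a b : ℝ) (p : ℝ[X]) :
    ∃ C : ℝ, ∀ x ∈ Set.Icc a b, p.eval x ∈ Set.Icc (-C) C := by
  obtain ⟨C, hC⟩ := (isCompact_Icc (a := a) (b := b)).exists_bound_of_continuousOn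
    p.continuous.continuousOn
  exact ⟨C, fun x hx => abs_le.mp (hC x hx)⟩

theorem quadError_approx_le (hnv : 0 < nv) [∀ l, IsProbabilityMeasure (Ψ l)]
    (hsupp : ∀ l, Ψ l (Set.Icc a b)ᶜ = 0) (hΨ : ∀ l (g : ℝ → ℝ), Integrable g (Ψ l))
    (hf : ∀ x ∈ Set.Icc a b, f x ∈ Set.Icc lo hi) {s : ℕ} {μ : Measure ℝ}
    (hμ : IsReference μ a b s) (hfm : AEMeasurable f μ) :
    quadError (approx μ s) Ψ f ≤
      (1 + dTV (avgSigned fun l => approxMeasure μ s (Ψ l))) * bestError s a b f := by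
  have hd := dTV_nonneg (avgSigned fun l => approxMeasure μ s (Ψ l))
  refine le_mul_bestError (by linarith) fun p hp => ?_
  -- The representation by signed measures is needed for p as well as for f, hence bounds for p on
  -- [a,b].
  obtain ⟨C, hC⟩ := exists_eval_mem_Icc a b p
  have hpm : AEMeasurable (fun x => p.eval x) μ := p.continuous.aemeasurable
  exact quadError_le_of_reproducing hnv (p := p) hsupp hΨ
    (variation_avgSigned_compl measurableSet_Icc fun l t ht hts =>
      hμ.approxMeasure_apply_eq_zero _ ht hts)
    (integrable_avgSigned fun l => hμ.integrable_approxMeasure hfm hf _)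
    (integrable_avgSigned fun l => hμ.integrable_approxMeasure hpm hC _)
    (quadIntegral_approx hΨ hf hμ hfm) (quadIntegral_approx hΨ hC hμ hpm)
    (fun l => hμ.approx_toPoly_eval _ hp) fun x hx => abs_sub_eval_le_uniformNorm hf _ hx

end Rules

end

end MatrixQuad

/-! ### The theorem -/

theorem mainTheorem2 {n nv : ℕ} (hn : 0 < n) (hnv : 0 < nv)
    (A : Matrix (Fin n) (Fin n) ℂ) (hA : A.IsHermitian)
    (a b : ℝ) (hspec : ∀ i, hA.eigenvalues i ∈ Set.Icc a b)
    (f : ℝ → ℝ) (fmin fmax : ℝ) (hf : ∀ x ∈ Set.Icc a b, fmin ≤ f x ∧ f x ≤ fmax)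
    {Ω : Type*} [MeasurableSpace Ω] (P : Measure Ω) [IsProbabilityMeasure P]
    (v : Fin nv → Ω → Metric.sphere (0 : EuclideanSpace ℝ (Fin n)) 1)
    (hlaw : ∀ l, HasLaw (v l) (unifSphere n) P) (hindep : iIndepFun v P)
    (Ψ : Ω → Fin nv → Measure ℝ) (hΨ : Ψ = fun ω l => weightedCESM hA (v l ω)) :
    -- every choice of the approximation operator
    (∀ (s : ℕ) (T : PolyApprox s),
      (∀ ε : ℝ, 0 < ε →
        P.real {ω | ‖(n : ℂ)⁻¹ * (hA.cfc f).trace - ((quadIntegral T (Ψ ω) f : ℝ) : ℂ)‖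
            > ε + quadError T (Ψ ω) f}
          ≤ if fmin < fmax then
              2 * n * Real.exp (-(nv * (n + 2) * ε ^ 2 / (fmax - fmin) ^ 2))
            else 0) ∧
      ∀ ω, quadError T (Ψ ω) f ≤
        (nv : ℝ)⁻¹ * ∑ l, uniformNorm a b (fun x => f x - (T.toPoly (Ψ ω l) f).eval x)) ∧
    -- Gaussian quadrature
    (∀ k : ℕ, 0 < k → ∀ ω,
      quadIntegral (gauss k) (Ψ ω) f
        = (∫ᵛ x, f x ∂•(avgSigned fun l => gaussMeasure k (Ψ ω l))) ∧
      quadError (gauss k) (Ψ ω) f ≤ 2 * bestError (2 * k - 1) a b f) ∧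
    -- quadrature by interpolation
    (∀ (s : ℕ) (μ : Measure ℝ), IsReference μ a b s → ∀ ω,
      quadIntegral (interp μ s) (Ψ ω) f
        = (∫ᵛ x, f x ∂•(avgSigned fun l => interpMeasure μ s (Ψ ω l))) ∧
      quadError (interp μ s) (Ψ ω) f
        ≤ (1 + dTV (avgSigned fun l => interpMeasure μ s (Ψ ω l))) * bestError s a b f) ∧
    -- quadrature by approximation
    (∀ (s : ℕ) (μ : Measure ℝ), IsReference μ a b s → AEMeasurable f μ → ∀ ω,
      quadIntegral (approx μ s) (Ψ ω) f
        = (∫ᵛ x, f x ∂•(avgSigned fun l => approxMeasure μ s (Ψ ω l))) ∧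
      quadError (approx μ s) (Ψ ω) f
        ≤ (1 + dTV (avgSigned fun l => approxMeasure μ s (Ψ ω l))) * bestError s a b f) := by
  have hΨi : ∀ ω l (g : ℝ → ℝ), Integrable g (Ψ ω l) := fun ω l g => by
    rw [hΨ]; exact integrable_weightedCESM hA _ g
  have hΨs : ∀ ω l, Ψ ω l (Set.Icc a b)ᶜ = 0 := fun ω l => by
    rw [hΨ]; exact weightedCESM_compl_eq_zero hA hspec _
  have hΨp : ∀ ω l, IsProbabilityMeasure (Ψ ω l) := fun ω l => by
    rw [hΨ]; exact isProbabilityMeasure_weightedCESM hA (by simp)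
  refine ⟨fun s T => ⟨fun ε hε => ?_, fun ω => quadError_le_uniformNorm T (hΨs ω) (hΨi ω) hf⟩,
    fun k hk ω => ⟨quadIntegral_of_nodeInterp (hΨi ω) fun _ => rfl,
      quadError_gauss_le hnv (hΨs ω) (hΨi ω) hf hk⟩,
    fun s μ hμ ω => ⟨quadIntegral_of_nodeInterp (hΨi ω) fun _ => rfl,
      quadError_interp_le hnv (hΨs ω) (hΨi ω) hf hμ⟩,
    fun s μ hμ hfm ω => ⟨quadIntegral_approx (hΨi ω) hf hμ hfm,
      quadError_approx_le hnv (hΨs ω) (hΨi ω) hf hμ hfm⟩⟩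
  -- By the triangle inequality through ∫ f d⟨Ψ_ℓ⟩, exceeding ε + e_s forces the sampling error
  -- alone to exceed ε; the rule disappears from the event.
  have hsub : {ω | ‖(n : ℂ)⁻¹ * (hA.cfc f).trace - ((quadIntegral T (Ψ ω) f : ℝ) : ℂ)‖
      > ε + quadError T (Ψ ω) f} ⊆ {ω | ε ≤ |∫ x, f x ∂(avgMeasure (Ψ ω)) -
        (n : ℝ)⁻¹ * ∑ i, f (hA.eigenvalues i)|} := by
    intro ω hω
    simp only [Set.mem_ofPred_eq] at hω ⊢
    have h1 : (n : ℂ)⁻¹ * (hA.cfc f).trace - ((quadIntegral T (Ψ ω) f : ℝ) : ℂ) =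
        (((n : ℝ)⁻¹ * ∑ i, f (hA.eigenvalues i) - quadIntegral T (Ψ ω) f : ℝ) : ℂ) := by
      rw [trace_cfc]; push_cast; ring
    rw [h1, Complex.norm_real, Real.norm_eq_abs] at hω
    have h2 := abs_sub_le ((n : ℝ)⁻¹ * ∑ i, f (hA.eigenvalues i))
      (∫ x, f x ∂(avgMeasure (Ψ ω))) (quadIntegral T (Ψ ω) f)
    rw [abs_sub_comm _ (∫ x, f x ∂(avgMeasure (Ψ ω)))] at h2
    rw [quadError] at hω
    linarith
  split_ifs with hlt
  · refine (measureReal_mono hsub (measure_ne_top _ _)).trans ?_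
    subst hΨ
    refine (measure_abs_integral_avgMeasure_sub_le hn hnv hA hspec hf hlt hlaw hindep hε).trans ?_
    have h1 : (1 : ℝ) ≤ n := by exact_mod_cast hn
    exact mul_le_mul_of_nonneg_right (by linarith) (Real.exp_pos _).le
  -- Here f is constant on [a,b], the sampling error is zero and the event is empty.
  · refine (measureReal_mono hsub (measure_ne_top _ _)).trans (le_of_eq ?_)
    convert! measureReal_empty
    refine Set.eq_empty_of_forall_notMem fun ω hω => ?_
    have hconst : ∀ x ∈ Set.Icc a b, f x ∈ Set.Icc fmin fmin := fun x hx =>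
      ⟨(hf x hx).1, (hf x hx).2.trans (not_lt.mp hlt)⟩
    have h1 : ∫ x, f x ∂(avgMeasure (Ψ ω)) = fmin := by
      rw [integral_avgMeasure fun l => hΨi ω l f, ← inv_mul_sum_const hnv fmin]
      congr 1
      refine Finset.sum_congr rfl fun l _ => ?_
      have h2 := integral_mem_Icc_of_supported (hΨs ω l) (hΨi ω l f) hconst
      exact le_antisymm h2.2 h2.1
    have h3 : (n : ℝ)⁻¹ * ∑ i, f (hA.eigenvalues i) = fmin := by
      rw [← inv_mul_sum_const hn fmin]
      congr 1
      refine Finset.sum_congr rfl fun i _ => ?_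
      exact le_antisymm (hconst _ (hspec i)).2 (hconst _ (hspec i)).1
    simp only [Set.mem_ofPred_eq] at hω
    rw [h1, h3, sub_self, abs_zero] at hω
    exact absurd hω (not_le.mpr hε)
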